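/- Let $G$ be a finite group and $c\subset G$ a conjugacy class such that $(G,c)$ is non-splitting: $c$ generates $G$, and for every subgroup $H\le G$ the set $c\cap H$ is either empty or a single conjugacy class of $H$. For a field $k$ let $R=\bigoplus_{n\ge 0}R_n$ be the ring of components of the associated Hurwitz spaces, i.e. the graded $k$-algebra for which $R_n$ has basis $c^n/\beta_n$, where the elementary braid $\sigma_i$ acts by $(g_1,\dots,g_n)\mapsto(g_1,\dots,g_{i-1},g_ig_{i+1}g_i^{-1},g_i,g_{i+2},\dots,g_n)$, and multiplication is concatenation of tuples. Regard $k$ as an $R$-module via the projection $R\to R_0=k$. For an $\mathbb N$-graded left $R$-module $M$ let $H^R_{n,d}(M)=\operatorname{Tor}^R_d(k,M)_n$ be the homology in grading $n$ and homological degree $d$ of $k\otimes^{\mathbb L}_R M$ (computed by the bar construction), and let $h^R_d(M)\in\mathbb N\cup\{\infty\}$ be the least $D$ such that $H^R_{n,d}(M)=0$ for all $n>D$. (1) There is a constant $B_1\in\mathbb N$, depending only on $(G,c)$, such that for every field $k$ in which $|G|$ is invertible, every $\mathbb N$-graded left $R$-module $M$ and every $d\ge 1$, $$h^R_d(M)\le\max\bigl(h^R_0(M),h^R_1(M)\bigr)+B_1\cdot(d-1).$$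 (2) One can take $B_1=N_0-1$ in the following sense: if $|G|$ is invertible in the field $k$, and $N_0\ge N\ge 1$ and $U\in R_N$ are such that both $U\cdot-$ and $-\cdot U$ are isomorphisms $R_{n-N}\to R_n$ for all $n\ge N_0$, then for every $\mathbb N$-graded left $R$-module $M$ and every $d\ge 1$, $$h^R_d(M)\le\max\bigl(h^R_0(M),h^R_1(M)\bigr)+(N_0-1)(d-1).$$ -/

import Mathlib

namespace Hurwitz

universe u v w

section Components

variable {G : Type u} [Group G]

/-- The pair `(G, c)` has the non-splitting property: `c` generates `G`, and for each subgroup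
`H ≤ G` the set `c ∩ H` is either empty or a single conjugacy class of `H`. -/
structure NonSplitting (c : ConjClasses G) : Prop where
  closure_eq_top : Subgroup.closure c.carrier = ⊤
  inter_subgroup : ∀ H : Subgroup G, c.carrier ∩ (H : Set G) = ∅ ∨
    ∃ cH : ConjClasses H, c.carrier ∩ (H : Set G) = Subtype.val '' cH.carrier

/-- The elementary braid move `(g, h) ↦ (g h g⁻¹, g)` on words of length two in `c`. -/
inductive BraidMove (c : ConjClasses G) : FreeMonoid c.carrier → FreeMonoid c.carrier → Prop
  | swap (g h h' : c.carrier) (e : (h' : G) = g * h * (g : G)⁻¹) :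
      BraidMove c (FreeMonoid.of g * FreeMonoid.of h) (FreeMonoid.of h' * FreeMonoid.of g)

/-- The monoid `∐ₙ cⁿ / βₙ` under concatenation: words `[g₁, …, gₙ]` in `c`, where two words are
identified if they are related by a sequence of elementary braids, that is, by
`[…, gᵢ, gᵢ₊₁, …] = […, gᵢ gᵢ₊₁ gᵢ⁻¹, gᵢ, …]`. -/
abbrev ComponentMonoid (c : ConjClasses G) : Type u := PresentedMonoid (BraidMove c)

theorem BraidMove.lift_eq {c : ConjClasses G} (a b : FreeMonoid c.carrier) (h : BraidMove c a b) :
    FreeMonoid.lift (fun _ => Multiplicative.ofAdd (1 : ℕ)) a =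
      FreeMonoid.lift (fun _ => Multiplicative.ofAdd (1 : ℕ)) b := by
  cases h
  simp

/-- The number `n` of entries of `[g₁, …, gₙ]`. -/
def len {c : ConjClasses G} (s : ComponentMonoid c) : ℕ :=
  Multiplicative.toAdd
    (PresentedMonoid.lift (fun _ => Multiplicative.ofAdd (1 : ℕ)) BraidMove.lift_eq s)

/-- The ring of components `R = ⨁ₙ k{cⁿ / βₙ}`. -/
abbrev ComponentRing (k : Type v) [Field k] (c : ConjClasses G) : Type (max u v) :=
  MonoidAlgebra k (ComponentMonoid c)

/-- The graded piece `Rₙ = k{cⁿ / βₙ}` of the ring of components. -/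
noncomputable def grading (k : Type v) [Field k] (c : ConjClasses G) (n : ℕ) :
    Submodule k (ComponentRing k c) :=
  Submodule.span k (MonoidAlgebra.of k (ComponentMonoid c) '' {s | len s = n})

/-- `U ∈ R_N`, and left and right multiplication by `U` are bijections `R_{n-N} → R_n` for all
`n ≥ N₀`. -/
structure IsStabilizing (k : Type v) [Field k] (c : ConjClasses G) (N N₀ : ℕ)
    (U : ComponentRing k c) : Prop where
  mem : U ∈ grading k c N
  left : ∀ n, N₀ ≤ n →
    Set.BijOn (fun x => U * x) (grading k c (n - N) : Set (ComponentRing k c)) (grading k c n)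
  right : ∀ n, N₀ ≤ n →
    Set.BijOn (fun x => x * U) (grading k c (n - N) : Set (ComponentRing k c)) (grading k c n)

end Components

section Tor

variable {G : Type u} [Group G] (k : Type v) [Field k] (c : ConjClasses G)
  (M : Type w) [AddCommGroup M] [Module k M] [Module (ComponentRing k c) M]
  [IsScalarTower k (ComponentRing k c) M]

/-- The value on `s` of the augmentation `R → R₀ = k`, the projection to grading `0`. -/
def augmentation {c : ConjClasses G} (s : ComponentMonoid c) : k := if len s = 0 then 1 else 0

/-- The module `B_d(k, R, M) = k ⊗ R^{⊗ d} ⊗ M` of the two-sided bar construction. As `R` has the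
`k`-basis `ComponentMonoid c`, it is the module of finitely supported functions from `d`-tuples of
basis elements to `M`; `Finsupp.single s m` is `1 ⊗ s₁ ⊗ ⋯ ⊗ s_d ⊗ m`. -/
abbrev Bar (d : ℕ) : Type (max u w) :=
  (Fin d → ComponentMonoid c) →₀ M

/-- The differential of the bar construction: `s₁ ⊗ ⋯ ⊗ s_{d+1} ⊗ m` is sent to
`ε(s₁) s₂ ⊗ ⋯ ⊗ s_{d+1} ⊗ m + ∑_{j=1}^{d} (-1)^j s₁ ⊗ ⋯ ⊗ s_j s_{j+1} ⊗ ⋯ ⊗ s_{d+1} ⊗ m`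
`+ (-1)^{d+1} s₁ ⊗ ⋯ ⊗ s_d ⊗ s_{d+1} m`. -/
noncomputable def barD (d : ℕ) : Bar c M (d + 1) →ₗ[k] Bar c M d :=
  Finsupp.lsum k fun s =>
    augmentation k (s 0) • Finsupp.lsingle (Fin.tail s)
    + ∑ j : Fin d, (-1 : k) ^ ((j : ℕ) + 1) •
        Finsupp.lsingle (Fin.contractNth j.castSucc (fun x y => x * y) s)
    + (-1 : k) ^ (d + 1) • (Finsupp.lsingle (Fin.init s)).comp
        (Algebra.lsmul k k M (MonoidAlgebra.of k (ComponentMonoid c) (s (Fin.last d))))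

variable {M} (ℳ : ℕ → Submodule k M)

/-- The part `B_{n,d}` of grading `n` of `B_d(k, R, M)`, where `M` is graded by `ℳ`. -/
noncomputable def barPiece (n d : ℕ) : Submodule k (Bar c M d) :=
  Submodule.span k {x | ∃ (s : Fin d → ComponentMonoid c) (j : ℕ) (m : M),
    m ∈ ℳ j ∧ (∑ i, len (s i)) + j = n ∧ x = Finsupp.single s m}

/-- The cycles in bidegree `(n, d)`. -/
noncomputable def cycles (n : ℕ) : (d : ℕ) → Submodule k (Bar c M d)
  | 0 => barPiece k c ℳ n 0
  | d + 1 => barPiece k c ℳ n (d + 1) ⊓ LinearMap.ker (barD k c M d)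

/-- The boundaries in bidegree `(n, d)`. -/
noncomputable def boundaries (n d : ℕ) : Submodule k (Bar c M d) :=
  (barPiece k c ℳ n (d + 1)).map (barD k c M d)

/-- `H^R_{n,d}(M) = Tor^R_d(k, M)_n`, the homology in bidegree `(n, d)` of the bar construction. -/
abbrev TorR (n d : ℕ) : Type (max u w) :=
  cycles k c ℳ n d ⧸ (boundaries k c ℳ n d).comap (cycles k c ℳ n d).subtype

/-- The degree of an `ℕ`-graded object: the least `D ∈ ℕ ∪ {∞}` with `V n = 0` for all `n > D`. -/
noncomputable def topDegree (V : ℕ → Type w) : ℕ∞ :=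
  sInf {D : ℕ∞ | ∀ n : ℕ, D < (n : ℕ∞) → Subsingleton (V n)}

/-- `h^R_d(M)`, the degree of `H^R_{*,d}(M)`. -/
noncomputable def hR (d : ℕ) : ℕ∞ :=
  topDegree fun n => TorR k c ℳ n d

end Tor

end Hurwitz

/-! Write H_d for the homology of the bar construction and D for max(h_0(M), h_1(M)), assumed
finite. The argument is a syzygy induction driven by one element U of positive degree N that acts
bijectively on R in high gradings.

Since H_0(M) vanishes above D, a graded Nakayama argument (`exists_coverMap_eq`) gives a surjection
F → M with F free on generators of grading at most D. Let K be its kernel. The long exact sequence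
gives H_{d+1}(M) = 0 wherever H_d(K) = 0, and h_0(K) ≤ D because H_1(M) and H_0(F) vanish above D.
As K lies in F, multiplication by U is injective on K_{n-N} for n ≥ D + N₀.

Injectivity of U controls H_1 (`IsLeftStable.isAcyclicAt_one`). Cover K by a free F' with generators
in gradings at most D, with kernel K'. Multiplication by U maps onto F'_n and is injective on
K_{n-N}, hence maps K'_{n-N} onto K'_n. Since U has positive degree, its image dies in H_0, so
H_0(K')_n = 0 and H_1(K)_n = 0 for n ≥ D + N₀. Passing from M to K thus lowers the homological
degree by one and raises D by N₀ - 1; iterating proves (2).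

For (1), take U to be the sum of g^m over g in c, with m = |G|. The powers g^m are central in the
component monoid. If H is the subgroup generated by the entries of s, then g^m s depends only on the
H-conjugacy class of g, so by non-splitting it is the same element for every g in c ∩ H. This
defines a stabilization map on components, surjective in high gradings by pigeonhole and then
bijective by counting. Ordered by the subgroup H, multiplication by U is triangular, with this
bijection as diagonal part and coefficients |c ∩ H|. These divide |G|, hence are invertible in k.
The threshold comes from the monoid alone, so it does not depend on k. -/

namespace Hurwitz

universe u v w w'

/-! ### The bar complex of a monoid representation -/

section BarComplex

variable {k : Type v} [Field k] {S : Type u} [Monoid S]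

/-- A length function on a monoid: additive, and vanishing only at `1`. -/
structure IsLength (len : S → ℕ) : Prop where
  one : len 1 = 0
  mul : ∀ s t, len (s * t) = len s + len t
  eq_one : ∀ s, len s = 0 → s = 1

variable (len : S → ℕ)

variable (k) in
/-- The augmentation that is `1` on elements of length `0` and `0` on all others. -/
def lenAug (s : S) : k := if len s = 0 then 1 else 0

variable {M : Type w} [AddCommGroup M] [Module k M] (ρ : Representation k S M)

/-- The bar differential with coefficients in a representation of `S`. -/
noncomputable def bard (d : ℕ) : ((Fin (d + 1) → S) →₀ M) →ₗ[k] ((Fin d → S) →₀ M) :=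
  Finsupp.lsum k fun s =>
    lenAug k len (s 0) • Finsupp.lsingle (Fin.tail s)
    + ∑ j : Fin d, (-1 : k) ^ ((j : ℕ) + 1) •
        Finsupp.lsingle (Fin.contractNth j.castSucc (fun x y => x * y) s)
    + (-1 : k) ^ (d + 1) • (Finsupp.lsingle (Fin.init s)).comp (ρ (s (Fin.last d)))

theorem bard_single (d : ℕ) (s : Fin (d + 1) → S) (m : M) :
    bard len ρ d (Finsupp.single s m) =
      lenAug k len (s 0) • Finsupp.single (Fin.tail s) m
      + ∑ j : Fin d, (-1 : k) ^ ((j : ℕ) + 1) •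
          Finsupp.single (Fin.contractNth j.castSucc (fun x y => x * y) s) m
      + (-1 : k) ^ (d + 1) • Finsupp.single (Fin.init s) (ρ (s (Fin.last d)) m) := by
  simp [bard, LinearMap.sum_apply]

/-- A linear map between coefficient modules induces a map of bar constructions. -/
noncomputable abbrev barMap {M' : Type w'} [AddCommGroup M'] [Module k M'] (φ : M →ₗ[k] M')
    (d : ℕ) : ((Fin d → S) →₀ M) →ₗ[k] ((Fin d → S) →₀ M') :=
  Finsupp.mapRange.linearMap φ

theorem bard_barMap {M' : Type w'} [AddCommGroup M'] [Module k M'] {ρ : Representation k S M}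
    {ρ' : Representation k S M'} {φ : M →ₗ[k] M'} {len : S → ℕ} (hφ : ∀ s m, φ (ρ s m) = ρ' s (φ m)) (d : ℕ)
    (x : (Fin (d + 1) → S) →₀ M) :
    bard len ρ' d (barMap φ (d + 1) x) = barMap φ d (bard len ρ d x) := by
  induction x using Finsupp.induction_linear with
  | zero => simp
  | add x y hx hy => simp only [map_add, hx, hy]
  | single s m =>
    simp only [Finsupp.mapRange.linearMap_apply, Finsupp.mapRange_single, bard_single]
    simp only [← Finsupp.mapRange.linearMap_apply, map_add, map_sum, map_smul]
    simp only [Finsupp.mapRange.linearMap_apply, Finsupp.mapRange_single, hφ]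

variable (k S) in
/-- The free representation `k[S] ⊗ V`. -/
noncomputable def freeRep (V : Type w) [AddCommGroup V] [Module k V] :
    Representation k S (S →₀ V) where
  toFun s := Finsupp.lmapDomain V k (s * ·)
  map_one' := by ext; simp
  map_mul' s t := by ext; simp [mul_assoc]

@[simp]
theorem freeRep_single {V : Type w} [AddCommGroup V] [Module k V] (s t : S) (v : V) :
    freeRep k S V s (Finsupp.single t v) = Finsupp.single (s * t) v := by
  simp [freeRep]

section Homotopy

variable (k S) (V : Type w) [AddCommGroup V] [Module k V]

/-- The contracting homotopy of the bar construction of a free representation. -/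
noncomputable def barHtpy (d : ℕ) :
    ((Fin d → S) →₀ (S →₀ V)) →ₗ[k] ((Fin (d + 1) → S) →₀ (S →₀ V)) :=
  (-1 : k) ^ (d + 1) • Finsupp.lsum k fun s => Finsupp.lsum k fun t =>
    (Finsupp.lsingle (Fin.snoc s t : Fin (d + 1) → S)).comp (Finsupp.lsingle 1)

variable {k S V}

theorem barHtpy_single (d : ℕ) (s : Fin d → S) (t : S) (v : V) :
    barHtpy k S V d (Finsupp.single s (Finsupp.single t v)) =
      (-1 : k) ^ (d + 1) • Finsupp.single (Fin.snoc s t : Fin (d + 1) → S) (Finsupp.single 1 v) := by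
  rw [barHtpy, LinearMap.smul_apply, Finsupp.lsum_single, Finsupp.lsum_single]
  rfl

omit [Monoid S] in
theorem induction_single_single {d : ℕ} {p : ((Fin d → S) →₀ (S →₀ V)) → Prop}
    (x : (Fin d → S) →₀ (S →₀ V)) (h0 : p 0) (hadd : ∀ x y, p x → p y → p (x + y))
    (h : ∀ s t v, p (Finsupp.single s (Finsupp.single t v))) : p x := by
  induction x using Finsupp.induction_linear with
  | zero => exact h0
  | add x y hx hy => exact hadd x y hx hy
  | single s f =>
    induction f using Finsupp.induction_linear with
    | zero => simpa using h0
    | add f g hf hg => simpa using hadd _ _ hf hg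
    | single t v => exact h s t v

theorem contractNth_castSucc_snoc {d : ℕ} (s : Fin (d + 1) → S) (t : S) (j : Fin d) :
    Fin.contractNth j.castSucc.castSucc (fun x y => x * y) (Fin.snoc s t : Fin (d + 2) → S) =
      Fin.snoc (Fin.contractNth j.castSucc (fun x y => x * y) s) t := by
  ext i
  refine Fin.lastCases ?_ (fun i => ?_) i
  · rw [Fin.contractNth_apply_of_gt _ _ _ _ (by simp)]
    simp
  · rw [Fin.snoc_castSucc]
    rcases lt_trichotomy (i : ℕ) j with h | h | h
    · rw [Fin.contractNth_apply_of_lt _ _ _ _ (by simpa using h),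
        Fin.contractNth_apply_of_lt _ _ _ _ (by simpa using h), Fin.snoc_castSucc]
    · rw [Fin.contractNth_apply_of_eq _ _ _ _ (by simpa using h),
        Fin.contractNth_apply_of_eq _ _ _ _ (by simpa using h), Fin.snoc_castSucc,
        ← Fin.castSucc_succ, Fin.snoc_castSucc]
    · rw [Fin.contractNth_apply_of_gt _ _ _ _ (by simpa using h),
        Fin.contractNth_apply_of_gt _ _ _ _ (by simpa using h),
        ← Fin.castSucc_succ, Fin.snoc_castSucc]

theorem contractNth_last_snoc {d : ℕ} (s : Fin (d + 1) → S) (t : S) :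
    Fin.contractNth (Fin.last d).castSucc (fun x y => x * y) (Fin.snoc s t : Fin (d + 2) → S) =
      Fin.snoc (Fin.init s) (s (Fin.last d) * t) := by
  ext i
  refine Fin.lastCases ?_ (fun i => ?_) i
  · rw [Fin.contractNth_apply_of_eq _ _ _ _ (by simp)]
    simp
  · rw [Fin.contractNth_apply_of_lt _ _ _ _ (by simp), Fin.snoc_castSucc, Fin.snoc_castSucc]
    rfl

omit [Monoid S] in
theorem tail_snoc {d : ℕ} (s : Fin (d + 1) → S) (t : S) :
    Fin.tail (Fin.snoc s t : Fin (d + 2) → S) = Fin.snoc (Fin.tail s) t := by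
  ext i
  refine Fin.lastCases ?_ (fun i => ?_) i
  · simp [Fin.tail]
  · simp only [Fin.tail, Fin.snoc_castSucc]
    rw [← Fin.castSucc_succ, Fin.snoc_castSucc]

theorem bard_barHtpy_succ (d : ℕ) (x : (Fin (d + 1) → S) →₀ (S →₀ V)) :
    bard len (freeRep k S V) (d + 1) (barHtpy k S V (d + 1) x) =
      x - barHtpy k S V d (bard len (freeRep k S V) d x) := by
  induction x using induction_single_single with
  | h0 => simp
  | hadd x y hx hy => simp only [map_add, hx, hy]; abel
  | h s t v =>
    have h0 : (Fin.snoc s t : Fin (d + 2) → S) 0 = s 0 := by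
      rw [← Fin.castSucc_zero, Fin.snoc_castSucc]
    have h1 : (-1 : k) ^ (d + 1 + 1) * (-1) ^ (d + 1 + 1) = 1 := by
      rw [← mul_pow]; simp
    rw [barHtpy_single, map_smul, bard_single, bard_single, Fin.sum_univ_castSucc]
    simp only [h0, tail_snoc, contractNth_castSucc_snoc, contractNth_last_snoc, freeRep_single,
      Fin.snoc_last, Fin.init_snoc, mul_one, map_add, map_sum, map_smul, barHtpy_single,
      Fin.val_castSucc, Fin.val_last, smul_add, smul_smul, h1, one_smul]
    have h2 : (-1 : k) ^ (d + 1 + 1) = -(-1) ^ (d + 1) := by rw [pow_succ]; ring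
    have h3 : (-1 : k) ^ (d + 1) * (-1) ^ (d + 1) = 1 := by
      rw [← mul_pow]; simp
    simp only [h2, neg_mul, h3, neg_smul, one_smul, Finset.smul_sum, smul_smul,
      Finset.sum_neg_distrib]
    simp only [mul_comm ((-1 : k) ^ (d + 1))]
    abel

/-- In degree 0 the homotopy contracts onto the augmentation, so a correction term survives. It
vanishes when `t` has positive length. -/
theorem bard_barHtpy_zero_single (s : Fin 0 → S) (t : S) (v : V) :
    bard len (freeRep k S V) 0 (barHtpy k S V 0 (Finsupp.single s (Finsupp.single t v))) =
      Finsupp.single s (Finsupp.single t v) -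
        lenAug k len t • Finsupp.single s (Finsupp.single 1 v) := by
  rw [barHtpy_single, map_smul, bard_single]
  have : Fin.tail (Fin.snoc s t : Fin 1 → S) = s := Subsingleton.elim _ _
  have h' : Fin.init (Fin.snoc s t : Fin 1 → S) = s := Subsingleton.elim _ _
  have h0 : (Fin.snoc s t : Fin 1 → S) 0 = t := by simp [Fin.snoc]
  simp [this, h', h0]
  abel

end Homotopy

variable {len}

theorem lenAug_mul (hlen : IsLength len) (s t : S) :
    lenAug k len (s * t) = lenAug k len s * lenAug k len t := by
  by_cases hs : len s = 0 <;> by_cases ht : len t = 0 <;> simp [lenAug, hlen.mul, hs, ht]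

/-- The representation map `k[S] ⊗ M → M`. -/
noncomputable def actionMap : (S →₀ M) →ₗ[k] M := Finsupp.lsum k fun s => ρ s

@[simp]
theorem actionMap_single (s : S) (m : M) : actionMap ρ (Finsupp.single s m) = ρ s m := by
  simp [actionMap]

theorem actionMap_freeRep (s : S) (f : S →₀ M) :
    actionMap ρ (freeRep k S M s f) = ρ s (actionMap ρ f) := by
  induction f using Finsupp.induction_linear with
  | zero => simp
  | add f g hf hg => simp only [map_add, hf, hg]
  | single t v => simp

/-- Each generator is, up to sign, the image under the equivariant action map k[S] ⊗ M → M of an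
element in the range of the homotopy. So d² = 0 need only be checked on that range, over free
representations. -/
theorem bard_bard_of_barHtpy {d : ℕ}
    (h : ∀ y, bard len (freeRep k S M) d (bard len (freeRep k S M) (d + 1)
      (barHtpy k S M (d + 1) y)) = 0) (x : (Fin (d + 2) → S) →₀ M) :
    bard len ρ d (bard len ρ (d + 1) x) = 0 := by
  induction x using Finsupp.induction_linear with
  | zero => simp
  | add x y hx hy => simp only [map_add, hx, hy, add_zero]
  | single s m =>
    have hs : Finsupp.single s m = barMap (actionMap ρ) (d + 2) ((-1 : k) ^ (d + 2) •
        barHtpy k S M (d + 1)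
          (Finsupp.single (Fin.init s) (Finsupp.single (s (Fin.last (d + 1))) m))) := by
      rw [barHtpy_single, smul_smul, ← mul_pow]
      simp
    rw [hs, bard_barMap (actionMap_freeRep ρ), bard_barMap (actionMap_freeRep ρ),
      map_smul, map_smul, h, smul_zero, map_zero]

/-- With h the homotopy, two uses of ∂h = 1 - h∂ turn ∂∂h into h∂∂, which vanishes by induction. In
the base case the two correction terms cancel because the augmentation is multiplicative. The
universe of `M` is large enough that `S →₀ M` stays in it. -/
theorem bard_bard_aux (hlen : IsLength len) (d : ℕ) : ∀ (M : Type (max u w)) [AddCommGroup M]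
    [Module k M] (ρ : Representation k S M) (x : (Fin (d + 2) → S) →₀ M),
    bard len ρ d (bard len ρ (d + 1) x) = 0 := by
  induction d with
  | zero =>
    intro M _ _ ρ
    refine bard_bard_of_barHtpy ρ fun y => ?_
    rw [bard_barHtpy_succ, map_sub]
    induction y using induction_single_single with
    | h0 => simp
    | hadd x y hx hy =>
      simp only [map_add]
      rw [add_sub_add_comm, hx, hy, add_zero]
    | h s t v =>
      rw [bard_single]
      simp only [Finset.univ_eq_empty, Finset.sum_empty, add_zero, zero_add, pow_one, map_add,
        map_smul, freeRep_single, bard_barHtpy_zero_single]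
      have h1 : Fin.init s = Fin.tail s := Subsingleton.elim _ _
      rw [Fin.last_zero, lenAug_mul hlen, h1, mul_smul, smul_sub, smul_sub]
      simp
  | succ d ih =>
    intro M _ _ ρ
    refine bard_bard_of_barHtpy ρ fun y => ?_
    rw [bard_barHtpy_succ, map_sub, bard_barHtpy_succ, ih]
    simp

theorem bard_bard (hlen : IsLength len) (d : ℕ) (x : (Fin (d + 2) → S) →₀ M) :
    bard len ρ d (bard len ρ (d + 1) x) = 0 :=
  bard_bard_of_barHtpy ρ (fun _ => bard_bard_aux.{u, v, w} hlen d _ _ _) x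

end BarComplex

/-! ### Graded pieces and vanishing of homology -/

section Acyclicity

variable {k : Type v} [Field k] {S : Type u} [Monoid S]

section Pieces

variable {M : Type w} [AddCommGroup M] [Module k M] {M' : Type w'} [AddCommGroup M'] [Module k M']

/-- The piece `ℳ (n - l)`, or `0` if `n < l`. -/
def shiftPiece (ℳ : ℕ → Submodule k M) (n l : ℕ) : Submodule k M :=
  if l ≤ n then ℳ (n - l) else ⊥

theorem mem_shiftPiece_of_add {ℳ : ℕ → Submodule k M} {n l j : ℕ} {m : M} (h : l + j = n)
    (hm : m ∈ ℳ j) : m ∈ shiftPiece ℳ n l := by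
  obtain rfl : j = n - l := by omega
  rwa [shiftPiece, if_pos (by omega)]

theorem exists_of_mem_shiftPiece {ℳ : ℕ → Submodule k M} {n l : ℕ} {m : M}
    (h : m ∈ shiftPiece ℳ n l) : m = 0 ∨ ∃ j, l + j = n ∧ m ∈ ℳ j := by
  unfold shiftPiece at h
  split_ifs at h with hl
  · exact .inr ⟨n - l, by omega, h⟩
  · exact .inl h

/-- The piece of grading `n` of the bar construction, described by coefficients. -/
def barGr (len : S → ℕ) (ℳ : ℕ → Submodule k M) (n d : ℕ) :
    Submodule k ((Fin d → S) →₀ M) where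
  carrier := {x | ∀ s, x s ∈ shiftPiece ℳ n (∑ i, len (s i))}
  add_mem' {x y} hx hy s := by
    rw [Finsupp.add_apply]
    exact add_mem (hx s) (hy s)
  zero_mem' s := zero_mem _
  smul_mem' a x hx s := by
    rw [Finsupp.smul_apply]
    exact Submodule.smul_mem _ a (hx s)

variable {len : S → ℕ} {ℳ : ℕ → Submodule k M} {ℳ' : ℕ → Submodule k M'} {n d : ℕ}

omit [Monoid S] in
theorem single_mem_barGr {s : Fin d → S} {j : ℕ} {m : M} (hm : m ∈ ℳ j)
    (h : ∑ i, len (s i) + j = n) : Finsupp.single s m ∈ barGr len ℳ n d := by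
  classical
  intro t
  rw [Finsupp.single_apply]
  split_ifs with hst
  · subst hst
    exact mem_shiftPiece_of_add h hm
  · exact zero_mem _

omit [Monoid S] in
theorem barGr_le {P : Submodule k ((Fin d → S) →₀ M)}
    (h : ∀ (s : Fin d → S) (j : ℕ) (m : M), m ∈ ℳ j → ∑ i, len (s i) + j = n →
      Finsupp.single s m ∈ P) : barGr len ℳ n d ≤ P := by
  intro x hx
  rw [← Finsupp.sum_single x]
  refine Submodule.sum_mem _ fun s _ => ?_
  rcases exists_of_mem_shiftPiece (hx s) with h0 | ⟨j, hj, hm⟩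
  · simp [h0]
  · exact h s j _ hm hj

omit [Monoid S] in
theorem barMap_mem_barGr {φ : M →ₗ[k] M'} (hφ : ∀ j m, m ∈ ℳ j → φ m ∈ ℳ' j)
    {x : (Fin d → S) →₀ M} (hx : x ∈ barGr len ℳ n d) : barMap φ d x ∈ barGr len ℳ' n d := by
  refine (barGr_le (P := (barGr len ℳ' n d).comap (barMap φ d)) fun s j m hm hj => ?_) hx
  simpa using single_mem_barGr (hφ j m hm) hj

omit [Monoid S] in
theorem exists_barMap_eq {φ : M →ₗ[k] M'} (hφ : ∀ j, ∀ m' ∈ ℳ' j, ∃ m ∈ ℳ j, φ m = m')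
    {x : (Fin d → S) →₀ M'} (hx : x ∈ barGr len ℳ' n d) :
    ∃ y ∈ barGr len ℳ n d, barMap φ d y = x := by
  refine (barGr_le (P := (barGr len ℳ n d).map (barMap φ d)) fun s j m hm hj => ?_) hx
  obtain ⟨m, hm', rfl⟩ := hφ j m hm
  exact ⟨_, single_mem_barGr hm' hj, by simp⟩

omit [Monoid S] in
theorem exists_barMap_subtype_eq {φ : M →ₗ[k] M'} {x : (Fin d → S) →₀ M}
    (hx : x ∈ barGr len ℳ n d) (h0 : barMap φ d x = 0) :
    ∃ z ∈ barGr len (fun j => (ℳ j).comap (LinearMap.ker φ).subtype) n d,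
      barMap (LinearMap.ker φ).subtype d z = x := by
  have hk (s) : x s ∈ LinearMap.ker φ := by
    simpa using DFunLike.congr_fun h0 s
  refine ⟨Finsupp.onFinset x.support (fun s => ⟨x s, hk s⟩) fun s hs => ?_, fun s => ?_, ?_⟩
  · rw [Finsupp.mem_support_iff]
    exact fun h => hs (Subtype.ext h)
  · rw [Finsupp.onFinset_apply]
    rcases exists_of_mem_shiftPiece (hx s) with h | ⟨j, hj, hm⟩
    · have : (⟨x s, hk s⟩ : LinearMap.ker φ) = 0 := Subtype.ext h
      rw [this]
      exact zero_mem _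
    · exact mem_shiftPiece_of_add hj hm
  · ext s
    simp

omit [Monoid S] in
theorem barMap_subtype_injective (K : Submodule k M) (d : ℕ) :
    Function.Injective (barMap (S := S) K.subtype d) :=
  Finsupp.mapRange_injective _ (map_zero _) K.injective_subtype

end Pieces

section Differential

variable {M : Type w} [AddCommGroup M] [Module k M] {len : S → ℕ} {ρ : Representation k S M}
  {ℳ : ℕ → Submodule k M} {n d : ℕ}

variable (len ρ ℳ) in
/-- Elements of the monoid shift the grading by their length. -/
def IsGradedRep : Prop := ∀ s j m, m ∈ ℳ j → ρ s m ∈ ℳ (len s + j)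

theorem len_partialProd_last (hlen : IsLength len) (s : Fin d → S) :
    len (Fin.partialProd s (Fin.last d)) = ∑ i, len (s i) := by
  induction d with
  | zero => simp [Fin.partialProd, hlen.one]
  | succ d ih =>
    rw [← Fin.succ_last, Fin.partialProd_succ, hlen.mul, Fin.sum_univ_castSucc, ← ih]
    congr 2
    simp only [Fin.partialProd, Fin.val_castSucc, Fin.val_last]
    rw [List.ofFn_succ']
    simp only [List.concat_eq_append]
    rw [List.take_left' (by simp), List.take_of_length_le (by simp)]

/-- Both sides are the length of the product of all entries, which contraction does not change. -/
theorem sum_len_contractNth (hlen : IsLength len) (s : Fin (d + 1) → S) (j : Fin d) :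
    ∑ i, len (Fin.contractNth j.castSucc (fun x y => x * y) s i) = ∑ i, len (s i) := by
  rw [← len_partialProd_last hlen, ← len_partialProd_last hlen, Fin.partialProd_contractNth]
  congr 1
  simp only [Function.comp_apply]
  congr 1
  rw [← Fin.castSucc_succ, Fin.succAbove_castSucc_of_le _ _ (Fin.le_last _), Fin.succ_last]

theorem bard_mem_barGr (hlen : IsLength len) (hρ : IsGradedRep len ρ ℳ)
    {x : (Fin (d + 1) → S) →₀ M} (hx : x ∈ barGr len ℳ n (d + 1)) :
    bard len ρ d x ∈ barGr len ℳ n d := by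
  refine (barGr_le (P := (barGr len ℳ n d).comap (bard len ρ d)) fun s j m hm hj => ?_) hx
  rw [Submodule.mem_comap, bard_single]
  refine add_mem (add_mem ?_ ?_) ?_
  · by_cases h0 : len (s 0) = 0
    · refine Submodule.smul_mem _ _ (single_mem_barGr hm ?_)
      rw [Fin.sum_univ_succ, h0, zero_add] at hj
      exact hj
    · simp [lenAug, h0]
  · refine Submodule.sum_mem _ fun i _ => Submodule.smul_mem _ _ (single_mem_barGr hm ?_)
    rwa [sum_len_contractNth hlen]
  · refine Submodule.smul_mem _ _ (single_mem_barGr (hρ _ _ _ hm) ?_)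
    rw [Fin.sum_univ_castSucc, add_assoc] at hj
    exact hj

variable (len ρ) in
/-- The cycles of the bar construction. -/
def IsBarCycle : (d : ℕ) → ((Fin d → S) →₀ M) → Prop
  | 0, _ => True
  | d + 1, x => bard len ρ d x = 0

variable (len ρ ℳ) in
/-- The bar construction has no homology in bidegree `(n, d)`. -/
def IsAcyclicAt (n d : ℕ) : Prop :=
  ∀ x ∈ barGr len ℳ n d, IsBarCycle len ρ d x → ∃ y ∈ barGr len ℳ n (d + 1), bard len ρ d y = x

end Differential

/-! ### Dimension shifting along a graded surjection -/

section DimensionShift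

variable {F : Type w} [AddCommGroup F] [Module k F] {M : Type w'} [AddCommGroup M] [Module k M]
  {len : S → ℕ} {σ : Representation k S F} {ρ : Representation k S M}
  {ℱ : ℕ → Submodule k F} {ℳ : ℕ → Submodule k M} {φ : F →ₗ[k] M}

/-- The kernel of an equivariant map as a representation. -/
abbrev kerRep (hφ : ∀ s f, φ (σ s f) = ρ s (φ f)) : Representation k S (LinearMap.ker φ) :=
  σ.subrepresentation (LinearMap.ker φ) fun s f hf => by
    rw [Submodule.mem_comap, LinearMap.mem_ker, hφ, LinearMap.mem_ker.1 hf, map_zero]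

variable (φ ℱ) in
/-- The grading of the kernel of `φ`. -/
abbrev kerGr (j : ℕ) : Submodule k (LinearMap.ker φ) := (ℱ j).comap (LinearMap.ker φ).subtype

theorem isGradedRep_kerRep (hφ : ∀ s f, φ (σ s f) = ρ s (φ f)) (hσ : IsGradedRep len σ ℱ) :
    IsGradedRep len (kerRep hφ) (kerGr ℱ φ) :=
  fun s j m hm => hσ s j m hm

/-- Exactness of H_{d+1}(F) → H_{d+1}(M) → H_d(ker φ), as an explicit diagram chase. -/
theorem IsAcyclicAt.succ_of_ker (hlen : IsLength len) (hφ : ∀ s f, φ (σ s f) = ρ s (φ f))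
    (hσ : IsGradedRep len σ ℱ) (hφm : ∀ j f, f ∈ ℱ j → φ f ∈ ℳ j)
    (hφs : ∀ j, ∀ m ∈ ℳ j, ∃ f ∈ ℱ j, φ f = m) {n d : ℕ} (hF : IsAcyclicAt len σ ℱ n (d + 1))
    (hK : IsAcyclicAt len (kerRep hφ) (kerGr ℱ φ) n d) : IsAcyclicAt len ρ ℳ n (d + 1) := by
  intro x hx hx0
  obtain ⟨y, hy, rfl⟩ := exists_barMap_eq hφs hx
  have hy0 : barMap φ d (bard len σ d y) = 0 := by
    rw [← bard_barMap hφ]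
    exact hx0
  obtain ⟨z, hz, hzy⟩ := exists_barMap_subtype_eq (bard_mem_barGr hlen hσ hy) hy0
  have hz0 : IsBarCycle len (kerRep hφ) d z := by
    cases d with
    | zero => trivial
    | succ d =>
      apply barMap_subtype_injective
      rw [← bard_barMap (ρ' := σ) (fun _ _ => rfl), hzy, bard_bard σ hlen, map_zero]
  obtain ⟨w, hw, rfl⟩ := hK z hz hz0
  rw [← bard_barMap (ρ' := σ) (fun _ _ => rfl)] at hzy
  obtain ⟨t, ht, hty⟩ := hF (y - barMap (LinearMap.ker φ).subtype (d + 1) w)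
    (sub_mem hy (barMap_mem_barGr (fun _ _ h => h) hw))
    (by simp only [IsBarCycle]; rw [map_sub, hzy, sub_self])
  refine ⟨barMap φ (d + 2) t, barMap_mem_barGr hφm ht, ?_⟩
  rw [bard_barMap hφ, hty, map_sub]
  have : barMap φ (d + 1) (barMap (LinearMap.ker φ).subtype (d + 1) w) = 0 := by
    ext s
    simp
  rw [this, sub_zero]

/-- Exactness of H_{d+1}(M) → H_d(ker φ) → H_d(F). -/
theorem IsAcyclicAt.ker (hlen : IsLength len) (hφ : ∀ s f, φ (σ s f) = ρ s (φ f))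
    (hφm : ∀ j f, f ∈ ℱ j → φ f ∈ ℳ j) (hφs : ∀ j, ∀ m ∈ ℳ j, ∃ f ∈ ℱ j, φ f = m)
    (hσ : IsGradedRep len σ ℱ)
    {n d : ℕ} (hF : IsAcyclicAt len σ ℱ n d) (hM : IsAcyclicAt len ρ ℳ n (d + 1)) :
    IsAcyclicAt len (kerRep hφ) (kerGr ℱ φ) n d := by
  intro z hz hz0
  have hz0' : IsBarCycle len σ d (barMap (LinearMap.ker φ).subtype d z) := by
    cases d with
    | zero => trivial
    | succ d =>
      simp only [IsBarCycle] at hz0 ⊢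
      rw [bard_barMap (ρ := kerRep hφ) (fun _ _ => rfl), hz0, map_zero]
  obtain ⟨y, hy, hyz⟩ := hF _ (barMap_mem_barGr (fun _ _ h => h) hz) hz0'
  obtain ⟨x, hx, hxy⟩ := hM (barMap φ (d + 1) y) (barMap_mem_barGr hφm hy) (by
    simp only [IsBarCycle]
    rw [bard_barMap hφ, hyz]
    ext s
    simp)
  obtain ⟨t, ht, rfl⟩ := exists_barMap_eq hφs hx
  rw [bard_barMap hφ, ← sub_eq_zero, ← map_sub, ← neg_eq_zero, ← map_neg, neg_sub] at hxy
  obtain ⟨w, hw, hwy⟩ := exists_barMap_subtype_eq (sub_mem hy (bard_mem_barGr hlen hσ ht)) hxy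
  refine ⟨w, hw, barMap_subtype_injective _ _ ?_⟩
  rw [← bard_barMap (ρ' := σ) (fun _ _ => rfl), hwy, map_sub, bard_bard σ hlen, hyz, sub_zero]

end DimensionShift

/-! ### Free modules with generators in gradings at most D -/

section Free

variable {D : ℕ} {W : Fin (D + 1) → Type w} [∀ j, AddCommGroup (W j)] [∀ j, Module k (W j)]

variable (k W) in
/-- The grading of `k[S] ⊗ ⨁ j, W j` with `W j` in grading `j`. -/
def freeGr (len : S → ℕ) (n : ℕ) : Submodule k (S →₀ ∀ j, W j) where
  carrier := {f | ∀ s j, f s j ≠ 0 → len s + j = n}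
  add_mem' {f g} hf hg s j h := by
    by_cases h' : f s j = 0
    · refine hg s j fun h'' => h ?_
      simp [h', h'']
    · exact hf s j h'
  zero_mem' s j h := absurd rfl h
  smul_mem' a f hf s j h := hf s j fun h' => h (by simp [h'])

variable {len : S → ℕ} {n d : ℕ}

omit [Monoid S] in
theorem single_mem_freeGr {s : S} {j : Fin (D + 1)} (a : W j) (h : len s + j = n) :
    Finsupp.single s (Pi.single j a) ∈ freeGr k W len n := by
  classical
  intro t i h0
  rw [Finsupp.single_apply] at h0
  split_ifs at h0 with hst
  · by_cases hij : i = j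
    · rw [← hst, hij, h]
    · simp [hij] at h0
  · simp at h0

omit [Monoid S] in
theorem freeGr_le {P : Submodule k (S →₀ ∀ j, W j)}
    (h : ∀ s j (a : W j), len s + j = n → Finsupp.single s (Pi.single j a) ∈ P) :
    freeGr k W len n ≤ P := by
  intro f hf
  rw [← Finsupp.sum_single f]
  refine Submodule.sum_mem _ fun s _ => ?_
  rw [← Finset.univ_sum_single (f s), ← Finsupp.lsingle_apply (R := k), map_sum]
  refine Submodule.sum_mem _ fun j _ => ?_
  by_cases h0 : f s j = 0
  · simp [h0]
  · exact h s j _ (hf s j h0)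

theorem isGradedRep_freeRep (hlen : IsLength len) :
    IsGradedRep len (freeRep k S (∀ j, W j)) (freeGr k W len) := by
  intro s i f hf
  refine (freeGr_le (P := (freeGr k W len (len s + i)).comap (freeRep k S _ s))
    fun t j a h => ?_) hf
  rw [Submodule.mem_comap, freeRep_single]
  exact single_mem_freeGr a (by rw [hlen.mul, add_assoc, h])

omit [Monoid S] in
theorem barGr_freeGr_le {P : Submodule k ((Fin d → S) →₀ S →₀ ∀ j, W j)}
    (h : ∀ (s : Fin d → S) t i (a : W i), ∑ i, len (s i) + (len t + i) = n →
      Finsupp.single s (Finsupp.single t (Pi.single i a)) ∈ P) :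
    barGr len (freeGr k W len) n d ≤ P :=
  barGr_le fun s j f hf hj =>
    freeGr_le (P := P.comap (Finsupp.lsingle s)) (fun t i a hi => h s t i a (by rw [hi, hj])) hf

theorem barHtpy_mem_barGr (hlen : IsLength len) {x : (Fin d → S) →₀ S →₀ ∀ j, W j}
    (hx : x ∈ barGr len (freeGr k W len) n d) :
    barHtpy k S _ d x ∈ barGr len (freeGr k W len) n (d + 1) := by
  refine (barGr_freeGr_le (k := k) (W := W) (S := S) (P := (barGr len (freeGr k W len) n (d + 1)).comap (barHtpy k S _ d))
    fun s t i a h => ?_) hx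
  rw [Submodule.mem_comap, barHtpy_single]
  refine Submodule.smul_mem _ _
    (single_mem_barGr (j := i) (single_mem_freeGr a (by rw [hlen.one, zero_add])) ?_)
  rw [Fin.sum_univ_castSucc]
  simpa [add_assoc] using h

theorem isAcyclicAt_freeRep_succ (hlen : IsLength len) (n d : ℕ) :
    IsAcyclicAt len (freeRep k S _) (freeGr k W len) n (d + 1) := by
  intro x hx h0
  refine ⟨_, barHtpy_mem_barGr hlen hx, ?_⟩
  simp only [IsBarCycle] at h0
  rw [bard_barHtpy_succ, h0, map_zero, sub_zero]

/-- Above the generators every monoid coordinate has positive length, so the correction term of the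
homotopy vanishes. -/
theorem isAcyclicAt_freeRep_zero (hlen : IsLength len) (hn : D < n) :
    IsAcyclicAt len (freeRep k S _) (freeGr k W len) n 0 := by
  intro x hx _
  refine ⟨_, barHtpy_mem_barGr hlen hx, ?_⟩
  refine (barGr_freeGr_le (k := k) (W := W) (S := S) (P := LinearMap.eqLocus
    ((bard len (freeRep k S _) 0).comp (barHtpy k S _ 0)) LinearMap.id) fun s t i a h => ?_) hx
  rw [LinearMap.mem_eqLocus, LinearMap.comp_apply, bard_barHtpy_zero_single]
  have : len t ≠ 0 := by
    have := i.2
    simp at h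
    omega
  simp [lenAug, this]

end Free

/-! ### The free cover in gradings at most D -/

section Cover

variable {M : Type w} [AddCommGroup M] [Module k M] {len : S → ℕ} {ρ : Representation k S M}
  {ℳ : ℕ → Submodule k M} {D : ℕ}

theorem mapRange_freeRep {V : Type w} {V' : Type w'} [AddCommGroup V] [Module k V]
    [AddCommGroup V'] [Module k V'] (φ : V →ₗ[k] V') (s : S) (f : S →₀ V) :
    Finsupp.mapRange.linearMap φ (freeRep k S V s f) =
      freeRep k S V' s (Finsupp.mapRange.linearMap φ f) := by
  induction f using Finsupp.induction_linear with
  | zero => simp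
  | add f g hf hg => simp only [map_add, hf, hg]
  | single t v => simp

variable (ρ ℳ D) in
/-- The map to `M` from the free representation on the part of `M` of grading at most `D`. -/
noncomputable def coverMap : (S →₀ ∀ j : Fin (D + 1), ℳ j) →ₗ[k] M :=
  (actionMap ρ).comp (Finsupp.mapRange.linearMap
    (∑ j : Fin (D + 1), (ℳ j).subtype.comp (LinearMap.proj j)))

theorem coverMap_single (s : S) (j : Fin (D + 1)) (m : ℳ j) :
    coverMap ρ ℳ D (Finsupp.single s (Pi.single j m)) = ρ s m := by
  simp only [coverMap, LinearMap.comp_apply, Finsupp.mapRange.linearMap_apply,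
    Finsupp.mapRange_single, actionMap_single, LinearMap.sum_apply, LinearMap.proj_apply]
  rw [Finset.sum_eq_single j]
  · simp
  · intro i _ hij
    simp [hij]
  · simp

theorem coverMap_freeRep (s : S) (f : S →₀ ∀ j : Fin (D + 1), ℳ j) :
    coverMap ρ ℳ D (freeRep k S _ s f) = ρ s (coverMap ρ ℳ D f) := by
  rw [coverMap, LinearMap.comp_apply, mapRange_freeRep, actionMap_freeRep]
  rfl

theorem coverMap_mem (hρ : IsGradedRep len ρ ℳ) (n : ℕ) (f : S →₀ ∀ j : Fin (D + 1), ℳ j)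
    (hf : f ∈ freeGr k (fun j : Fin (D + 1) => ℳ j) len n) : coverMap ρ ℳ D f ∈ ℳ n := by
  refine (freeGr_le (P := (ℳ n).comap (coverMap ρ ℳ D)) fun s j m h => ?_) hf
  rw [Submodule.mem_comap, coverMap_single, ← h]
  exact hρ s j m m.2

/-- Graded Nakayama, by strong induction on the grading: above `D` an element is a boundary, hence a
combination of products of positive-length monoid elements with elements of smaller grading. -/
theorem exists_coverMap_eq (hlen : IsLength len) (h : ∀ n, D < n → IsAcyclicAt len ρ ℳ n 0)
    (n : ℕ) : ∀ m ∈ ℳ n,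
    ∃ f ∈ freeGr k (fun j : Fin (D + 1) => ℳ j) len n, coverMap ρ ℳ D f = m := by
  induction n using Nat.strong_induction_on with
  | _ n ih =>
    intro m hm
    rcases le_or_gt n D with hn | hn
    · refine ⟨Finsupp.single 1 (Pi.single ⟨n, by omega⟩ ⟨m, hm⟩), single_mem_freeGr _ ?_, ?_⟩
      · rw [hlen.one, zero_add]
      · rw [coverMap_single]
        simp
    · obtain ⟨y, hy, hym⟩ := h n hn (Finsupp.single default m) (single_mem_barGr hm (by simp))
        trivial
      have hle : barGr len ℳ n 1 ≤ ((freeGr k (fun j : Fin (D + 1) => ℳ j) len n).map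
          (coverMap ρ ℳ D)).comap ((Finsupp.lapply default).comp (bard len ρ 0)) := by
        refine barGr_le fun s j m' hm' hj => ?_
        rw [Submodule.mem_comap, LinearMap.comp_apply, bard_single]
        simp only [Finset.univ_eq_empty, Finset.sum_empty, add_zero, zero_add, pow_one, map_add,
          map_smul, Finsupp.lapply_apply, neg_smul, one_smul]
        rw [Subsingleton.elim (Fin.tail s) default, Subsingleton.elim (Fin.init s) default,
          Finsupp.single_eq_same, Finsupp.neg_apply, Finsupp.single_eq_same,
          Fin.last_zero]
        simp only [Fin.sum_univ_one] at hj
        -- Length 0 forces `s 0 = 1`, where the two faces cancel; otherwise only the action term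
        -- remains and `m'` has smaller grading.
        by_cases hs : len (s 0) = 0
        · rw [hlen.eq_one _ hs]
          simp [lenAug, hlen.one]
        · obtain ⟨f, hf, rfl⟩ := ih j (by omega) m' hm'
          refine ⟨-freeRep k S _ (s 0) f, neg_mem ?_, ?_⟩
          · rw [← hj]
            exact isGradedRep_freeRep hlen _ _ _ hf
          · rw [map_neg, coverMap_freeRep]
            simp [lenAug, hs]
      have := hle hy
      rw [Submodule.mem_comap, LinearMap.comp_apply, hym] at this
      simpa using this

end Cover

end Acyclicity

/-! ### Stable elements and the syzygy induction -/

section Stability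

variable {k : Type v} [Field k] {S : Type u} [Monoid S]

theorem asAlgebraHom_eq_sum {M : Type w} [AddCommGroup M] [Module k M] (ρ : Representation k S M)
    (U : MonoidAlgebra k S) (m : M) :
    ρ.asAlgebraHom U m = U.coeff.sum fun s a => a • ρ s m := by
  rw [Representation.asAlgebraHom_def, MonoidAlgebra.lift_apply, Finsupp.sum, Finsupp.sum,
    LinearMap.sum_apply]
  rfl

theorem map_asAlgebraHom {M : Type w} [AddCommGroup M] [Module k M] {M' : Type w'}
    [AddCommGroup M'] [Module k M'] {ρ : Representation k S M} {ρ' : Representation k S M'}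
    {φ : M →ₗ[k] M'} (hφ : ∀ s m, φ (ρ s m) = ρ' s (φ m)) (U : MonoidAlgebra k S) (m : M) :
    φ (ρ.asAlgebraHom U m) = ρ'.asAlgebraHom U (φ m) := by
  simp only [asAlgebraHom_eq_sum, Finsupp.sum, map_sum, map_smul, hφ]

/-- `U` is homogeneous of length `N`, and left multiplication by `U` is bijective on `k[S]` in
gradings at least `N₀`. -/
structure IsLeftStable (len : S → ℕ) (N N₀ : ℕ) (U : MonoidAlgebra k S) : Prop where
  homogeneous : ∀ s, U.coeff s ≠ 0 → len s = N
  injective : ∀ n, N₀ ≤ n → ∀ x : S →₀ k, (∀ t, x t ≠ 0 → len t = n - N) →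
    (freeRep k S k).asAlgebraHom U x = 0 → x = 0
  surjective : ∀ n, N₀ ≤ n → ∀ s, len s = n → ∃ x : S →₀ k, (∀ t, x t ≠ 0 → len t = n - N) ∧
    (freeRep k S k).asAlgebraHom U x = Finsupp.single s 1

variable {len : S → ℕ} {N N₀ : ℕ} {U : MonoidAlgebra k S} {D : ℕ}

section Free

variable {W : Fin (D + 1) → Type w} [∀ j, AddCommGroup (W j)] [∀ j, Module k (W j)] {n : ℕ}

/-- Composing the coefficients in `W j` with linear functionals reduces to injectivity on k[S] in
grading n - j - N; the bound on `n` gives n - j ≥ N₀ for every generator grading j ≤ D. -/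
theorem IsLeftStable.eq_zero_of_freeGr (hU : IsLeftStable len N N₀ U) (hn : D + N₀ ≤ n)
    {x : S →₀ ∀ j, W j} (hx : x ∈ freeGr k W len (n - N))
    (h0 : (freeRep k S _).asAlgebraHom U x = 0) : x = 0 := by
  ext s j
  rw [Finsupp.zero_apply, Pi.zero_apply, ← Module.forall_dual_apply_eq_zero_iff k]
  intro f
  have hj := j.2
  have := hU.injective (n - j) (by omega)
    (Finsupp.mapRange.linearMap (f.comp (LinearMap.proj j)) x) (fun t ht => ?_) ?_
  · simpa using DFunLike.congr_fun this s
  · have := hx t j fun h => ht (by simp [h])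
    omega
  · rw [← map_asAlgebraHom (mapRange_freeRep _), h0, map_zero]

theorem IsLeftStable.exists_freeGr (hU : IsLeftStable len N N₀ U) (hN : N ≤ N₀)
    (hn : D + N₀ ≤ n) {y : S →₀ ∀ j, W j} (hy : y ∈ freeGr k W len n) :
    ∃ x ∈ freeGr k W len (n - N), (freeRep k S _).asAlgebraHom U x = y := by
  refine (freeGr_le (P := (freeGr k W len (n - N)).map ((freeRep k S _).asAlgebraHom U))
    fun s j a h => ?_) hy
  have hj := j.2
  obtain ⟨x, hx, hxs⟩ := hU.surjective (n - j) (by omega) s (by omega)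
  refine ⟨Finsupp.mapRange.linearMap (LinearMap.toSpanSingleton k _ (Pi.single j a)) x,
    fun t i ht => ?_, ?_⟩
  · by_cases hij : i = j
    · subst hij
      have := hx t fun h => ht (by simp [h])
      omega
    · simp [hij] at ht
  · rw [← map_asAlgebraHom (mapRange_freeRep _), hxs]
    simp

end Free

/-- The augmentation kills elements of positive length, so the boundary of s ⊗ m is -sm for each `s`
in the support of `U`, and Um is a boundary. -/
theorem isAcyclicAt_zero_of_asAlgebraHom {M : Type w} [AddCommGroup M] [Module k M]
    {ρ : Representation k S M} {ℳ : ℕ → Submodule k M} (hU : ∀ s, U.coeff s ≠ 0 → len s = N)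
    (hN0 : 0 < N) {n : ℕ} (hn : N ≤ n)
    (h : ∀ m ∈ ℳ n, ∃ m' ∈ ℳ (n - N), ρ.asAlgebraHom U m' = m) : IsAcyclicAt len ρ ℳ n 0 := by
  intro x hx _
  have hxd : x default ∈ ℳ n := by simpa [shiftPiece] using hx default
  obtain ⟨m, hm, hmx⟩ := h _ hxd
  refine ⟨-∑ s ∈ U.coeff.support, U.coeff s • Finsupp.single (fun _ => s) m,
    neg_mem (Submodule.sum_mem _ fun s hs => Submodule.smul_mem _ _ (single_mem_barGr hm ?_)), ?_⟩
  · rw [Fin.sum_univ_one, hU s (Finsupp.mem_support_iff.1 hs)]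
    omega
  · have hd : x = Finsupp.single default (x default) := by
      refine Finsupp.ext fun s => ?_
      rw [Subsingleton.elim s default, Finsupp.single_eq_same]
    rw [map_neg, map_sum, hd, ← hmx, asAlgebraHom_eq_sum, Finsupp.sum, ← Finset.sum_neg_distrib,
      ← Finsupp.lsingle_apply (R := k), map_sum]
    refine Finset.sum_congr rfl fun s hs => ?_
    have hs0 : len s ≠ 0 := by
      rw [hU s (Finsupp.mem_support_iff.1 hs)]
      omega
    rw [map_smul, bard_single, map_smul]
    simp only [lenAug, hs0, if_false, zero_smul, Finset.univ_eq_empty, Finset.sum_empty, zero_add,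
      pow_one, neg_smul, one_smul, smul_neg, neg_neg, Finsupp.lsingle_apply]
    rw [Subsingleton.elim (Fin.init fun _ => s) default]

theorem kerRep_asAlgebraHom {F : Type w} [AddCommGroup F] [Module k F] {M : Type w'}
    [AddCommGroup M] [Module k M] {σ : Representation k S F} {ρ : Representation k S M}
    {φ : F →ₗ[k] M} (hφ : ∀ s f, φ (σ s f) = ρ s (φ f)) (U : MonoidAlgebra k S)
    (x : LinearMap.ker φ) :
    ((kerRep hφ).asAlgebraHom U x : F) = σ.asAlgebraHom U x :=
  map_asAlgebraHom (φ := (LinearMap.ker φ).subtype) (ρ := kerRep hφ) (ρ' := σ)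
    (fun _ _ => rfl) U x

/-- A kernel element of grading `n` is Ux with `x` in the free module; injectivity of `U` on `ℳ (n -
N)` puts `x` in the kernel. So `U` is onto the kernel in grading `n`. -/
theorem IsLeftStable.isAcyclicAt_ker (hU : IsLeftStable len N N₀ U) (hN0 : 0 < N) (hN : N ≤ N₀)
    {W : Fin (D + 1) → Type w} [∀ j, AddCommGroup (W j)] [∀ j, Module k (W j)]
    {M : Type w'} [AddCommGroup M] [Module k M] {ρ : Representation k S M}
    {ℳ : ℕ → Submodule k M} {φ : (S →₀ ∀ j, W j) →ₗ[k] M}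
    (hφ : ∀ s f, φ (freeRep k S _ s f) = ρ s (φ f))
    (hφm : ∀ j f, f ∈ freeGr k W len j → φ f ∈ ℳ j) {n : ℕ} (hn : D + N₀ ≤ n)
    (h0 : ∀ m ∈ ℳ (n - N), ρ.asAlgebraHom U m = 0 → m = 0) :
    IsAcyclicAt len (kerRep hφ) (kerGr (freeGr k W len) φ) n 0 := by
  refine isAcyclicAt_zero_of_asAlgebraHom hU.homogeneous hN0 (by omega) fun m hm => ?_
  obtain ⟨x, hx, hxm⟩ := hU.exists_freeGr hN hn (y := (m : S →₀ ∀ j, W j)) hm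
  have hx0 : x ∈ LinearMap.ker φ := by
    refine LinearMap.mem_ker.2 (h0 _ (hφm _ _ hx) ?_)
    rw [← map_asAlgebraHom hφ, hxm]
    exact m.2
  exact ⟨⟨x, hx0⟩, hx, Subtype.ext ((kerRep_asAlgebraHom hφ U _).trans hxm)⟩

theorem IsLeftStable.isAcyclicAt_one (hlen : IsLength len) (hU : IsLeftStable len N N₀ U)
    (hN0 : 0 < N) (hN : N ≤ N₀) {M : Type w} [AddCommGroup M] [Module k M]
    {ρ : Representation k S M} {ℳ : ℕ → Submodule k M} (hρ : IsGradedRep len ρ ℳ)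
    (h0 : ∀ n, D < n → IsAcyclicAt len ρ ℳ n 0) {n : ℕ} (hn : D + N₀ ≤ n)
    (hinj : ∀ m ∈ ℳ (n - N), ρ.asAlgebraHom U m = 0 → m = 0) : IsAcyclicAt len ρ ℳ n 1 :=
  IsAcyclicAt.succ_of_ker hlen coverMap_freeRep (isGradedRep_freeRep hlen) (coverMap_mem hρ)
    (exists_coverMap_eq hlen h0) (isAcyclicAt_freeRep_succ hlen n 0)
    (hU.isAcyclicAt_ker hN0 hN coverMap_freeRep (coverMap_mem hρ) hn hinj)

/-- The inductive step: the syzygy is the kernel of the free cover. It inherits the injectivity of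
`U` from the free module, which bounds its H_1. -/
theorem IsLeftStable.exists_syzygy (hlen : IsLength len) (hU : IsLeftStable len N N₀ U)
    (hN0 : 0 < N) (hN : N ≤ N₀) {M : Type w} [AddCommGroup M] [Module k M]
    {ρ : Representation k S M} {ℳ : ℕ → Submodule k M} (hρ : IsGradedRep len ρ ℳ)
    (h0 : ∀ n, D < n → IsAcyclicAt len ρ ℳ n 0) (h1 : ∀ n, D < n → IsAcyclicAt len ρ ℳ n 1) :
    ∃ (K : Type (max u w)) (_ : AddCommGroup K) (_ : Module k K) (σ : Representation k S K)
      (𝒦 : ℕ → Submodule k K), IsGradedRep len σ 𝒦 ∧ (∀ n, D < n → IsAcyclicAt len σ 𝒦 n 0) ∧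
      (∀ n, D + (N₀ - 1) < n → IsAcyclicAt len σ 𝒦 n 1) ∧
      ∀ n d, IsAcyclicAt len σ 𝒦 n d → IsAcyclicAt len ρ ℳ n (d + 1) := by
  have hφs := exists_coverMap_eq hlen h0
  have hφ : ∀ s f, coverMap ρ ℳ D (freeRep k S _ s f) = ρ s (coverMap ρ ℳ D f) := coverMap_freeRep
  have hF := isGradedRep_freeRep (k := k) (W := fun j : Fin (D + 1) => ℳ j) hlen
  have hK := isGradedRep_kerRep hφ hF
  have hK0 (n : ℕ) (hn : D < n) := IsAcyclicAt.ker hlen hφ (coverMap_mem hρ) hφs hF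
    (isAcyclicAt_freeRep_zero hlen hn) (h1 n hn)
  have hK1 (n : ℕ) (hn : D + (N₀ - 1) < n) :
      IsAcyclicAt len (kerRep hφ) (kerGr (freeGr k (fun j : Fin (D + 1) => ℳ j) len) _) n 1 := by
    refine hU.isAcyclicAt_one hlen hN0 hN hK hK0 (by omega) fun m hm hm0 => Subtype.ext ?_
    refine hU.eq_zero_of_freeGr (by omega : D + N₀ ≤ n) hm ?_
    rw [← kerRep_asAlgebraHom hφ, hm0]
    rfl
  have hK2 (n d : ℕ) := IsAcyclicAt.succ_of_ker (n := n) (d := d) hlen hφ hF (coverMap_mem hρ) hφs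
    (isAcyclicAt_freeRep_succ hlen n d)
  exact ⟨LinearMap.ker (coverMap ρ ℳ D), inferInstance, inferInstance, kerRep hφ,
    kerGr (freeGr k (fun j : Fin (D + 1) => ℳ j) len) _, hK, hK0, hK1, hK2⟩

theorem IsLeftStable.isAcyclicAt_aux (hlen : IsLength len) (hU : IsLeftStable len N N₀ U)
    (hN0 : 0 < N) (hN : N ≤ N₀) (d : ℕ) : ∀ (D : ℕ) {M : Type (max u w)} [AddCommGroup M]
    [Module k M] {ρ : Representation k S M} {ℳ : ℕ → Submodule k M}, IsGradedRep len ρ ℳ →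
    (∀ n, D < n → IsAcyclicAt len ρ ℳ n 0) → (∀ n, D < n → IsAcyclicAt len ρ ℳ n 1) →
    ∀ n, D + (N₀ - 1) * d < n → IsAcyclicAt len ρ ℳ n (d + 1) := by
  induction d with
  | zero => exact fun D M _ _ ρ ℳ _ _ h1 n hn => h1 n (by simpa using hn)
  | succ d ih =>
    intro D M _ _ ρ ℳ hρ h0 h1 n hn
    obtain ⟨K, _, _, σ, 𝒦, hσ, hK0, hK1, hK⟩ :=
      IsLeftStable.exists_syzygy.{u, v, max u w} hlen hU hN0 hN hρ h0 h1
    exact hK _ _ (ih (D + (N₀ - 1)) hσ (fun n hn => hK0 n (by omega)) hK1 n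
      (by rw [mul_add, mul_one] at hn; omega))

/-- Left multiplication by a stabilizing element bounds the vanishing range of all homology of a
graded module in terms of that of its homology in degrees `0` and `1`. -/
theorem IsLeftStable.isAcyclicAt (hlen : IsLength len) (hU : IsLeftStable len N N₀ U)
    (hN0 : 0 < N) (hN : N ≤ N₀) {M : Type w} [AddCommGroup M]
    [Module k M] {ρ : Representation k S M} {ℳ : ℕ → Submodule k M} (hρ : IsGradedRep len ρ ℳ)
    (h0 : ∀ n, D < n → IsAcyclicAt len ρ ℳ n 0) (h1 : ∀ n, D < n → IsAcyclicAt len ρ ℳ n 1)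
    (d n : ℕ) (hn : D + (N₀ - 1) * d < n) : IsAcyclicAt len ρ ℳ n (d + 1) := by
  cases d with
  | zero => exact h1 n (by simpa using hn)
  | succ d =>
    -- The first syzygy is taken separately because it moves the module into the universe `max u w`,
    -- where the induction can run.
    obtain ⟨K, _, _, σ, 𝒦, hσ, hK0, hK1, hK⟩ := hU.exists_syzygy hlen hN0 hN hρ h0 h1
    exact hK _ _ (IsLeftStable.isAcyclicAt_aux.{u, v, w} hlen hU hN0 hN d (D + (N₀ - 1)) hσ
      (fun n hn => hK0 n (by omega)) hK1 n (by rw [mul_add, mul_one] at hn; omega))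

end Stability

/-! ### Components, their grading, and Tor as bar homology -/

section Translation

variable {G : Type u} [Group G] {c : ConjClasses G}

theorem len_one : len (1 : ComponentMonoid c) = 0 := by simp [len]

theorem len_mul (s t : ComponentMonoid c) : len (s * t) = len s + len t := by simp [len]

theorem len_of (g : c.carrier) : len (PresentedMonoid.of (BraidMove c) g) = 1 := by simp [len]

theorem len_mk (a : FreeMonoid c.carrier) :
    len (PresentedMonoid.mk (BraidMove c) a) = a.length := by
  induction a using FreeMonoid.inductionOn' with
  | one => rw [map_one, len_one, FreeMonoid.length_one]
  | of_mul g a ih => rw [map_mul, len_mul, ih, FreeMonoid.length_mul, FreeMonoid.length_of]; rfl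

theorem isLength_len : IsLength (len : ComponentMonoid c → ℕ) where
  one := len_one
  mul := len_mul
  eq_one s h := by
    obtain ⟨a, rfl⟩ := PresentedMonoid.surjective_mk s
    rw [len_mk, FreeMonoid.length_eq_zero] at h
    rw [h, map_one]

theorem topDegree_le_iff {V : ℕ → Type w} {D : ℕ} :
    topDegree V ≤ D ↔ ∀ n, D < n → Subsingleton (V n) := by
  constructor
  · intro h n hn
    obtain ⟨E, hE, hEn⟩ := sInf_lt_iff.1 (lt_of_le_of_lt h (Nat.cast_lt.2 hn))
    exact hE n hEn
  · exact fun h => sInf_le fun n hn => h n (Nat.cast_lt.1 hn)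

variable {k : Type v} [Field k]

theorem mem_grading_iff {n : ℕ} {x : ComponentRing k c} :
    x ∈ grading k c n ↔ ∀ s, x.coeff s ≠ 0 → len s = n := by
  classical
  constructor
  · intro hx
    induction hx using Submodule.span_induction with
    | mem x hx =>
      obtain ⟨t, ht, rfl⟩ := hx
      intro s hs
      rw [MonoidAlgebra.of_apply, MonoidAlgebra.coeff_single, Finsupp.single_apply] at hs
      split_ifs at hs with hst
      · exact hst ▸ ht
      · exact absurd rfl hs
    | zero => exact fun s hs => absurd rfl hs
    | add x y _ _ hx hy =>
      intro s hs
      by_cases h : x.coeff s = 0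
      · refine hy s fun h' => hs ?_
        rw [MonoidAlgebra.coeff_add, Finsupp.add_apply, h, h', add_zero]
      · exact hx s h
    | smul a x _ hx =>
      refine fun s hs => hx s fun h => hs ?_
      rw [MonoidAlgebra.coeff_smul, Finsupp.smul_apply, h, smul_zero]
  · intro h
    have hx : x = ∑ s ∈ x.coeff.support, x.coeff s • MonoidAlgebra.of k (ComponentMonoid c) s := by
      apply MonoidAlgebra.coeff_injective
      rw [MonoidAlgebra.coeff_sum]
      conv_lhs => rw [← Finsupp.sum_single x.coeff]
      simp [Finsupp.sum]
    rw [hx]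
    exact Submodule.sum_mem _ fun s hs => Submodule.smul_mem _ _
      (Submodule.subset_span ⟨s, h s (Finsupp.mem_support_iff.1 hs), rfl⟩)

theorem asAlgebraHom_freeRep {S : Type u} [Monoid S] (U : MonoidAlgebra k S) (x : S →₀ k) :
    (freeRep k S k).asAlgebraHom U x = (U * MonoidAlgebra.ofCoeff x).coeff := by
  induction x using Finsupp.induction_linear with
  | zero => simp
  | add x y hx hy => rw [map_add, hx, hy, MonoidAlgebra.ofCoeff_add, mul_add, MonoidAlgebra.coeff_add]
  | single t a =>
    induction U using MonoidAlgebra.induction_linear with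
    | zero => simp
    | add U V hU hV => rw [map_add, LinearMap.add_apply, hU, hV, add_mul, MonoidAlgebra.coeff_add]
    | single s b => simp [Representation.asAlgebraHom_single]

theorem IsStabilizing.isLeftStable {N N₀ : ℕ} {U : ComponentRing k c}
    (hU : IsStabilizing k c N N₀ U) : IsLeftStable len N N₀ U where
  homogeneous := mem_grading_iff.1 hU.mem
  injective n hn x hx h0 := by
    rw [asAlgebraHom_freeRep, MonoidAlgebra.coeff_eq_zero] at h0
    have := (hU.left n hn).injOn (mem_grading_iff.2 hx : MonoidAlgebra.ofCoeff x ∈ grading k c _)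
      (zero_mem (grading k c _)) (h0.trans (mul_zero U).symm)
    exact MonoidAlgebra.ofCoeff_eq_zero.1 this
  surjective n hn s hs := by
    obtain ⟨x, hx, hxs⟩ := (hU.left n hn).surjOn
      (Submodule.subset_span ⟨s, hs, rfl⟩ : MonoidAlgebra.of k (ComponentMonoid c) s ∈ grading k c n)
    refine ⟨x.coeff, mem_grading_iff.1 hx, ?_⟩
    rw [asAlgebraHom_freeRep, MonoidAlgebra.ofCoeff_coeff]
    exact congrArg MonoidAlgebra.coeff hxs

variable {M : Type w} [AddCommGroup M] [Module k M] [Module (ComponentRing k c) M]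
  [IsScalarTower k (ComponentRing k c) M] (ℳ : ℕ → Submodule k M)

variable (k c M) in
/-- The representation of the monoid of components on a module over the ring of components. -/
noncomputable abbrev moduleRep : Representation k (ComponentMonoid c) M :=
  Representation.ofModule' M

theorem barD_eq_bard (d : ℕ) : barD k c M d = bard len (moduleRep c k M) d := rfl

omit [Module (ComponentRing k c) M] [IsScalarTower k (ComponentRing k c) M] in
theorem barPiece_eq_barGr (n d : ℕ) : barPiece k c ℳ n d = barGr len ℳ n d := by
  refine le_antisymm (Submodule.span_le.2 ?_) (barGr_le fun s j m hm hj =>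
    Submodule.subset_span ⟨s, j, m, hm, hj, rfl⟩)
  rintro x ⟨s, j, m, hm, hj, rfl⟩
  exact single_mem_barGr hm hj

theorem mem_cycles_iff {n d : ℕ} {x : Bar c M d} :
    x ∈ cycles k c ℳ n d ↔ x ∈ barGr len ℳ n d ∧ IsBarCycle len (moduleRep c k M) d x := by
  cases d with
  | zero => simp [cycles, barPiece_eq_barGr, IsBarCycle]
  | succ d => simp [cycles, barPiece_eq_barGr, IsBarCycle, barD_eq_bard]

theorem subsingleton_torR_iff {n d : ℕ} :
    Subsingleton (TorR k c ℳ n d) ↔ IsAcyclicAt len (moduleRep c k M) ℳ n d := by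
  rw [Submodule.Quotient.subsingleton_iff, Submodule.comap_subtype_eq_top]
  simp only [SetLike.le_def, mem_cycles_iff, boundaries, Submodule.mem_map, barPiece_eq_barGr,
    barD_eq_bard, and_imp, IsAcyclicAt]

theorem hR_le_iff {d D : ℕ} :
    hR k c ℳ d ≤ D ↔ ∀ n, D < n → IsAcyclicAt len (moduleRep c k M) ℳ n d := by
  simp only [hR, topDegree_le_iff, subsingleton_torR_iff]

theorem IsLeftStable.hR_le {N N₀ : ℕ} {U : ComponentRing k c} (hU : IsLeftStable len N N₀ U)
    (hN0 : 0 < N) (hN : N ≤ N₀) [SetLike.GradedSMul (grading k c) ℳ] {d : ℕ} (hd : 1 ≤ d) :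
    hR k c ℳ d ≤ max (hR k c ℳ 0) (hR k c ℳ 1) + (((N₀ - 1) * (d - 1) : ℕ) : ℕ∞) := by
  obtain ⟨d, rfl⟩ : ∃ e, d = e + 1 := ⟨d - 1, by omega⟩
  rcases eq_or_ne (max (hR k c ℳ 0) (hR k c ℳ 1)) ⊤ with h | h
  · rw [h, top_add]
    exact le_top
  · obtain ⟨D, hD⟩ := ENat.ne_top_iff_exists.1 h
    rw [← hD, ← Nat.cast_add, hR_le_iff]
    have hρ : IsGradedRep len (moduleRep c k M) ℳ := fun s j m hm =>
      SetLike.GradedSMul.smul_mem (A := grading k c) (i := len s)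
        (Submodule.subset_span ⟨s, rfl, rfl⟩) hm
    exact hU.isAcyclicAt isLength_len hN0 hN hρ
      ((hR_le_iff ℳ).1 ((le_max_left _ _).trans hD.ge))
      ((hR_le_iff ℳ).1 ((le_max_right _ _).trans hD.ge)) d

end Translation

/-! ### Central powers and stabilization of components -/

section Stabilization

variable {G : Type u} [Group G] {c : ConjClasses G}

/-- The component of a word of length one. -/
abbrev letter (g : c.carrier) : ComponentMonoid c := PresentedMonoid.of (BraidMove c) g

/-- Conjugation on a conjugacy class. -/
def conjBy (x : G) (g : c.carrier) : c.carrier :=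
  ⟨x * g * x⁻¹, by
    refine ConjClasses.mem_carrier_iff_mk_eq.2
      (Eq.trans ?_ (ConjClasses.mem_carrier_iff_mk_eq.1 g.2))
    rw [ConjClasses.mk_eq_mk_iff_isConj, isConj_comm, isConj_iff]
    exact ⟨x, rfl⟩⟩

@[simp]
theorem coe_conjBy (x : G) (g : c.carrier) : (conjBy x g : G) = x * g * x⁻¹ := rfl

theorem conjBy_one (g : c.carrier) : conjBy 1 g = g := Subtype.ext (by simp)

theorem conjBy_mul (x y : G) (g : c.carrier) : conjBy (x * y) g = conjBy x (conjBy y g) :=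
  Subtype.ext (by simp [mul_assoc])

theorem conjBy_self (g : c.carrier) : conjBy (g : G) g = g := Subtype.ext (by simp)

theorem letter_mul_letter (g h : c.carrier) :
    letter g * letter h = letter (conjBy (g : G) h) * letter g :=
  PresentedMonoid.mk_eq_mk_of_rel (BraidMove.swap g h _ rfl)

theorem component_induction {p : ComponentMonoid c → Prop} (one : p 1)
    (mul : ∀ g s, p s → p (letter g * s)) (s : ComponentMonoid c) : p s := by
  obtain ⟨a, rfl⟩ := PresentedMonoid.surjective_mk s
  induction a using FreeMonoid.inductionOn' with
  | one => simpa using one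
  | of_mul g a ih => rw [map_mul]; exact mul g _ ih

theorem len_letter_pow (g : c.carrier) (n : ℕ) : len (letter g ^ n) = n := by
  induction n with
  | zero => rw [pow_zero, len_one]
  | succ n ih => rw [pow_succ, len_mul, ih, len_of]

variable (c) in
/-- The product of the entries of a word. -/
def boundaryHom : ComponentMonoid c →* G :=
  PresentedMonoid.lift (rels := BraidMove c) (fun g : c.carrier => (g : G)) fun a b h => by
    obtain ⟨g, h, h', e⟩ := h
    simp [e]

@[simp]
theorem boundaryHom_letter (g : c.carrier) : boundaryHom c (letter g) = g := rfl

/-- Passing a letter leftwards across `s` conjugates it by the product of the entries of `s`. -/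
theorem mul_letter (s : ComponentMonoid c) (h : c.carrier) :
    s * letter h = letter (conjBy (boundaryHom c s) h) * s := by
  induction s using component_induction with
  | one => simp [conjBy_one]
  | mul g s ih =>
    rw [mul_assoc, ih, ← mul_assoc, letter_mul_letter, mul_assoc, map_mul, boundaryHom_letter,
      conjBy_mul]

theorem letter_mul_letter_pow (h g : c.carrier) (n : ℕ) :
    letter h * letter g ^ n = letter (conjBy (h : G) g) ^ n * letter h := by
  induction n with
  | zero => simp
  | succ n ih => rw [pow_succ, ← mul_assoc, ih, mul_assoc, letter_mul_letter, ← mul_assoc, pow_succ]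

/-- The product of the entries of `letter g ^ m` is trivial, so letters cross it unchanged. -/
theorem letter_pow_mul {m : ℕ} {g : c.carrier} (hg : (g : G) ^ m = 1) (s : ComponentMonoid c) :
    letter g ^ m * s = s * letter g ^ m := by
  induction s using component_induction with
  | one => simp
  | mul h s ih =>
    rw [← mul_assoc, mul_letter, map_pow, boundaryHom_letter, hg, conjBy_one, mul_assoc, ih,
      mul_assoc]

section Support

/-- A join-semilattice with bottom, regarded as a monoid under joins. -/
def JoinMonoid (α : Type u) : Type u := α

instance (α : Type u) [SemilatticeSup α] [OrderBot α] : Monoid (JoinMonoid α) where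
  mul a b := max (α := α) a b
  mul_assoc := sup_assoc (α := α)
  one := (⊥ : α)
  one_mul := bot_sup_eq (α := α)
  mul_one := sup_bot_eq (α := α)

variable (c) in
/-- The subgroup generated by the entries of a word, as a homomorphism. -/
def supportHom : ComponentMonoid c →* JoinMonoid (Subgroup G) :=
  PresentedMonoid.lift (M := JoinMonoid (Subgroup G)) (rels := BraidMove c)
    (fun g : c.carrier => Subgroup.zpowers (g : G))
    fun a b h => by
      obtain ⟨g, h, h', e⟩ := h
      simp only [map_mul]
      change Subgroup.zpowers (g : G) ⊔ Subgroup.zpowers (h : G) =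
        Subgroup.zpowers (h' : G) ⊔ Subgroup.zpowers (g : G)
      have hg {H : Subgroup G} : (g : G) ∈ Subgroup.zpowers (g : G) ⊔ H :=
        Subgroup.mem_sup_left (Subgroup.mem_zpowers _)
      have hg' {H : Subgroup G} : (g : G) ∈ H ⊔ Subgroup.zpowers (g : G) :=
        Subgroup.mem_sup_right (Subgroup.mem_zpowers _)
      apply le_antisymm <;> refine sup_le ?_ ?_ <;> rw [Subgroup.zpowers_le]
      · exact hg'
      · rw [show (h : G) = (g : G)⁻¹ * h' * g by rw [e]; group]
        exact mul_mem (mul_mem (inv_mem hg') (Subgroup.mem_sup_left (Subgroup.mem_zpowers _))) hg'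
      · rw [e]
        exact mul_mem (mul_mem hg (Subgroup.mem_sup_right (Subgroup.mem_zpowers _))) (inv_mem hg)
      · exact hg

/-- The subgroup generated by the entries of a word. -/
def supportSubgroup (s : ComponentMonoid c) : Subgroup G := supportHom c s

theorem supportSubgroup_one : supportSubgroup (1 : ComponentMonoid c) = ⊥ := map_one (supportHom c)

theorem supportSubgroup_mul (s t : ComponentMonoid c) :
    supportSubgroup (s * t) = supportSubgroup s ⊔ supportSubgroup t := map_mul (supportHom c) s t

theorem supportSubgroup_letter (g : c.carrier) :
    supportSubgroup (letter g) = Subgroup.zpowers (g : G) := rfl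

theorem supportSubgroup_letter_pow (g : c.carrier) {n : ℕ} (hn : n ≠ 0) :
    supportSubgroup (letter g ^ n) = Subgroup.zpowers (g : G) := by
  induction n with
  | zero => exact absurd rfl hn
  | succ n ih =>
    rw [pow_succ, supportSubgroup_mul, supportSubgroup_letter]
    rcases eq_or_ne n 0 with rfl | h
    · rw [pow_zero, supportSubgroup_one, bot_sup_eq]
    · rw [ih h, sup_idem]

/-- The conjugating elements that work for every `g` form a subgroup, so it suffices to treat the
entries of the word. For the first entry h, centrality brings g^m next to `s`, and carrying it back
across h conjugates it by h. -/
theorem letter_pow_mul_eq_of_mem {m : ℕ} (hm : ∀ g : c.carrier, (g : G) ^ m = 1)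
    (s : ComponentMonoid c) : ∀ x ∈ supportSubgroup s, ∀ g : c.carrier,
    letter g ^ m * s = letter (conjBy x g) ^ m * s := by
  induction s using component_induction with
  | one =>
    intro x hx g
    rw [supportSubgroup_one, Subgroup.mem_bot] at hx
    rw [hx, conjBy_one]
  | mul h s ih =>
    let X : Subgroup G :=
      { carrier := {x | ∀ g : c.carrier,
          letter g ^ m * (letter h * s) = letter (conjBy x g) ^ m * (letter h * s)}
        mul_mem' := fun {x y} hx hy g => by rw [conjBy_mul, ← hx, ← hy]
        one_mem' := fun g => by rw [conjBy_one]
        inv_mem' := fun {x} hx g => by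
          rw [hx (conjBy x⁻¹ g), ← conjBy_mul, mul_inv_cancel, conjBy_one] }
    suffices supportSubgroup (letter h * s) ≤ X from fun x hx => this hx
    rw [supportSubgroup_mul, supportSubgroup_letter]
    refine sup_le (Subgroup.zpowers_le.2 fun g => ?_) fun x hx g => ?_
    · rw [← mul_assoc, letter_pow_mul (hm g), letter_mul_letter_pow, mul_assoc]
    · rw [← mul_assoc, letter_pow_mul (hm g), mul_assoc, ih x hx, ← mul_assoc,
        ← letter_pow_mul (hm _), mul_assoc]

end Support

section Words

/-- The component of a word. -/
def word (l : List c.carrier) : ComponentMonoid c := (l.map letter).prod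

theorem word_cons (g : c.carrier) (l : List c.carrier) : word (g :: l) = letter g * word l := by
  simp [word]

theorem exists_word_eq (s : ComponentMonoid c) : ∃ l : List c.carrier, word l = s := by
  induction s using component_induction with
  | one => exact ⟨[], rfl⟩
  | mul g s ih =>
    obtain ⟨l, rfl⟩ := ih
    exact ⟨g :: l, word_cons g l⟩

theorem len_word (l : List c.carrier) : len (word l) = l.length := by
  induction l with
  | nil => exact len_one
  | cons g l ih => rw [word_cons, len_mul, len_of, ih, List.length_cons, add_comm]

theorem finite_len_eq [Finite G] (n : ℕ) : {s : ComponentMonoid c | len s = n}.Finite := by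
  refine ((List.finite_length_eq c.carrier n).image word).subset fun s hs => ?_
  obtain ⟨l, rfl⟩ := exists_word_eq s
  exact ⟨l, (len_word l).symm.trans hs, rfl⟩

/-- Braiding `g` to the front conjugates the letters it crosses by `g⁻¹`. No letter other than `g`
becomes `g` in this way, so the remaining occurrences are preserved and the extraction can be
repeated. -/
theorem exists_letter_mul_word [DecidableEq c.carrier] {g : c.carrier} {l : List c.carrier} (hg : g ∈ l) :
    ∃ l' : List c.carrier, word l = letter g * word l' ∧ l'.count g + 1 = l.count g := by
  induction l with
  | nil => simp at hg
  | cons h l ih =>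
    rcases eq_or_ne h g with rfl | hne
    · exact ⟨l, word_cons h l, by simp⟩
    · obtain ⟨l', hl, hc⟩ := ih ((List.mem_cons.1 hg).resolve_left hne.symm)
      refine ⟨conjBy (g : G)⁻¹ h :: l', ?_, ?_⟩
      · rw [word_cons, hl, word_cons, ← mul_assoc, ← mul_assoc, letter_mul_letter g, ← conjBy_mul,
          mul_inv_cancel, conjBy_one]
      · have : conjBy (g : G)⁻¹ h ≠ g := fun e => hne (by
          rw [← conjBy_one h, ← mul_inv_cancel (g : G), conjBy_mul, e, conjBy_self])
        rw [List.count_cons_of_ne this, List.count_cons_of_ne hne, hc]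

theorem exists_letter_pow_mul_word [DecidableEq c.carrier] {g : c.carrier} (n : ℕ) {l : List c.carrier}
    (hg : n ≤ l.count g) :
    ∃ l' : List c.carrier, word l = letter g ^ n * word l' ∧ l'.count g + n = l.count g := by
  induction n with
  | zero => exact ⟨l, by simp, rfl⟩
  | succ n ih =>
    obtain ⟨l', hl, hc⟩ := ih (by omega)
    obtain ⟨l'', hl', hc'⟩ := exists_letter_mul_word (List.count_pos_iff.1 (by omega : 0 < l'.count g))
    exact ⟨l'', by rw [hl, hl', pow_succ, mul_assoc], by omega⟩

theorem exists_eq_letter_pow_mul [Finite G] (m : ℕ) {s : ComponentMonoid c}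
    (hs : m * Nat.card c.carrier < len s) : ∃ (g : c.carrier) (t : ComponentMonoid c),
      s = letter g ^ m * t ∧ (g : G) ∈ supportSubgroup t ∧
        supportSubgroup t = supportSubgroup s := by
  have := Classical.decEq c.carrier
  have := Fintype.ofFinite c.carrier
  obtain ⟨l, rfl⟩ := exists_word_eq s
  have : ∃ g : c.carrier, m < l.count g := by
    by_contra! h
    have h1 : ∑ g : c.carrier, l.count g = l.length := by
      simpa using Multiset.sum_count_eq_card (s := Finset.univ) (m := (l : Multiset c.carrier))
        (fun _ _ => Finset.mem_univ _)
    have h2 := Finset.sum_le_card_nsmul Finset.univ (fun g => l.count g) m fun g _ => h g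
    rw [h1, Finset.card_univ, ← Nat.card_eq_fintype_card, smul_eq_mul, mul_comm] at h2
    rw [len_word] at hs
    omega
  obtain ⟨g, hg⟩ := this
  -- One copy beyond `m` is extracted and left in the remainder, so that the remainder has the same
  -- support.
  obtain ⟨l', hl, -⟩ := exists_letter_pow_mul_word (m + 1) (Nat.succ_le_of_lt hg)
  refine ⟨g, letter g * word l', by rw [hl, pow_succ, mul_assoc], ?_, ?_⟩
  · rw [supportSubgroup_mul]
    exact Subgroup.mem_sup_left (Subgroup.mem_zpowers _)
  · rw [hl, supportSubgroup_mul, supportSubgroup_mul, supportSubgroup_letter_pow g (by omega),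
      supportSubgroup_letter]

end Words

section StabilizationMap

open Classical in
/-- Multiplication by the `m`-th power of some letter in the support. -/
noncomputable def stabMap (m : ℕ) (s : ComponentMonoid c) : ComponentMonoid c :=
  if h : ∃ g : c.carrier, (g : G) ∈ supportSubgroup s then letter h.choose ^ m * s else s

/-- This is where non-splitting makes the choice in `stabMap` immaterial: any two letters in the
support subgroup are conjugate inside it. -/
theorem NonSplitting.letter_pow_mul_eq_stabMap (hc : NonSplitting c) {m : ℕ}
    (hm : ∀ g : c.carrier, (g : G) ^ m = 1) {s : ComponentMonoid c} {g : c.carrier}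
    (hg : (g : G) ∈ supportSubgroup s) : letter g ^ m * s = stabMap m s := by
  have h : ∃ g : c.carrier, (g : G) ∈ supportSubgroup s := ⟨g, hg⟩
  rw [stabMap, dif_pos h]
  rcases hc.inter_subgroup (supportSubgroup s) with h0 | ⟨cH, hcH⟩
  · exact absurd ⟨g.2, hg⟩ (Set.eq_empty_iff_forall_notMem.1 h0 g)
  · obtain ⟨a, ha, hag⟩ := hcH.subset ⟨g.2, hg⟩
    obtain ⟨b, hb, hbg⟩ := hcH.subset ⟨h.choose.2, h.choose_spec⟩
    rw [ConjClasses.mem_carrier_iff_mk_eq] at ha hb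
    obtain ⟨x, hx⟩ := isConj_iff.1 (ConjClasses.mk_eq_mk_iff_isConj.1 (ha.trans hb.symm))
    rw [letter_pow_mul_eq_of_mem hm s x x.2 g]
    congr 3
    refine Subtype.ext ?_
    rw [coe_conjBy, ← hag, ← hbg, ← hx]
    rfl

theorem exists_mem_supportSubgroup {s : ComponentMonoid c} (hs : len s ≠ 0) :
    ∃ g : c.carrier, (g : G) ∈ supportSubgroup s := by
  obtain ⟨l, rfl⟩ := exists_word_eq s
  cases l with
  | nil => exact absurd len_one hs
  | cons g l =>
    refine ⟨g, ?_⟩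
    rw [word_cons, supportSubgroup_mul]
    exact Subgroup.mem_sup_left (Subgroup.mem_zpowers _)

theorem exists_forall_eq_of_le_of_shift {a : ℕ → ℕ} {m n₀ : ℕ} (ha : ∀ n, n₀ ≤ n → a (n + m) ≤ a n) :
    ∃ n₁, n₀ ≤ n₁ ∧ ∀ n, n₁ ≤ n → a (n + m) = a n := by
  have hb (n : ℕ) : ∑ i ∈ Finset.range m, a (n + 1 + i) + a n =
      ∑ i ∈ Finset.range m, a (n + i) + a (n + m) := by
    rw [← Finset.sum_range_succ (fun i => a (n + i)), Finset.sum_range_succ']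
    simp [add_assoc, add_comm 1]
  -- Sums over a window of length `m` form an antitone sequence of naturals. Once it reaches its
  -- minimum it is constant, which forces equality in each shift.
  let b (n : ℕ) : ℕ := ∑ i ∈ Finset.range m, a (n₀ + n + i)
  have hanti : Antitone b := antitone_nat_of_succ_le fun n => by
    have := hb (n₀ + n)
    have := ha (n₀ + n) (by omega)
    simp only [b, ← add_assoc]
    omega
  obtain ⟨N, hN⟩ : ∃ N, ∀ n, b N ≤ b n :=
    ⟨Function.argmin b, fun n => Function.argmin_le b n⟩
  refine ⟨n₀ + N, by omega, fun n hn => ?_⟩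
  obtain ⟨e, rfl⟩ := Nat.exists_eq_add_of_le (by omega : n₀ ≤ n)
  have h1 : b (e + 1) = b e := le_antisymm (hanti (by omega))
    ((hanti (by omega : N ≤ e)).trans (hN _))
  have := hb (n₀ + e)
  simp only [b, ← add_assoc] at h1
  omega

/-- Surjectivity comes from extracting an `m`-th power from a long word. The finite numbers of
components are then eventually non-increasing under the shift by `m`, hence eventually constant, and
a surjection between finite sets of equal size is injective. -/
theorem NonSplitting.exists_bijective_stabMap [Finite G] (hc : NonSplitting c) {m : ℕ}
    (hm : ∀ g : c.carrier, (g : G) ^ m = 1) :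
    ∃ n₁, 0 < n₁ ∧ ∀ n, n₁ ≤ n → Set.InjOn (stabMap m) {s : ComponentMonoid c | len s = n} ∧
      ∀ s : ComponentMonoid c, len s = n + m → ∃ t, len t = n ∧ stabMap m t = s ∧
        supportSubgroup t = supportSubgroup s := by
  have hsurj (n : ℕ) (hn : m * Nat.card c.carrier + 1 ≤ n) (s : ComponentMonoid c)
      (hs : len s = n + m) :
      ∃ t, len t = n ∧ stabMap m t = s ∧ supportSubgroup t = supportSubgroup s := by
    obtain ⟨g, t, rfl, hg, ht⟩ := exists_eq_letter_pow_mul m (s := s) (by omega)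
    rw [len_mul, len_letter_pow] at hs
    exact ⟨t, by omega, (hc.letter_pow_mul_eq_stabMap hm hg).symm, ht⟩
  have himage (n : ℕ) (hn : m * Nat.card c.carrier + 1 ≤ n) :
      stabMap m '' {s : ComponentMonoid c | len s = n} = {s | len s = n + m} := by
    ext s
    constructor
    · rintro ⟨t, ht, rfl⟩
      obtain ⟨g, hg⟩ := exists_mem_supportSubgroup (s := t) (by rw [Set.mem_ofPred_eq] at ht; omega)
      rw [← hc.letter_pow_mul_eq_stabMap hm hg, Set.mem_ofPred_eq, len_mul, len_letter_pow, ht,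
        add_comm]
    · intro hs
      obtain ⟨t, ht, hts, -⟩ := hsurj n hn s hs
      exact ⟨t, ht, hts⟩
  obtain ⟨n₁, hn₁, h⟩ := exists_forall_eq_of_le_of_shift
    (a := fun n => {s : ComponentMonoid c | len s = n}.ncard) (m := m)
    (n₀ := m * Nat.card c.carrier + 1) fun n hn => by
      rw [← himage n hn]
      exact Set.ncard_image_le (finite_len_eq n)
  refine ⟨n₁, by omega, fun n hn => ⟨?_, hsurj n (by omega)⟩⟩
  refine Set.injOn_of_ncard_image_eq ?_ (finite_len_eq n)
  rw [himage n (by omega)]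
  exact h n hn

end StabilizationMap

end Stabilization

/-! ### The power sum is a stable element -/

section StableElement

variable {G : Type u} [Group G] {c : ConjClasses G}

theorem card_carrier_dvd {H : Type u} [Group H] [Finite H] (C : ConjClasses H) :
    Nat.card C.carrier ∣ Nat.card H := by
  classical
  have := Fintype.ofFinite H
  obtain ⟨h, rfl⟩ := C.exists_rep
  rw [← ConjAct.orbit_eq_carrier_conjClasses, Nat.card_congr (ConjAct.toConjAct (G := H)).toEquiv,
    Nat.card_eq_fintype_card, Nat.card_eq_fintype_card,
    ← MulAction.card_orbit_mul_card_stabilizer_eq_card_group (ConjAct H) h]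
  exact dvd_mul_right _ _

/-- By non-splitting the letters in `H` form one conjugacy class of `H`. Their number is the
diagonal coefficient of the power sum, so it must be invertible in `k`. -/
theorem NonSplitting.card_filter_dvd [Finite G] [Fintype c.carrier] (hc : NonSplitting c)
    {H : Subgroup G} [DecidablePred fun g : c.carrier => (g : G) ∈ H]
    (hH : ∃ g : c.carrier, (g : G) ∈ H) :
    (Finset.univ.filter fun g : c.carrier => (g : G) ∈ H).card ∣ Nat.card G := by
  obtain ⟨g, hg⟩ := hH
  rcases hc.inter_subgroup H with h0 | ⟨C, hC⟩
  · exact absurd ⟨g.2, hg⟩ (Set.eq_empty_iff_forall_notMem.1 h0 g)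
  · have : (Finset.univ.filter fun g : c.carrier => (g : G) ∈ H).card = Nat.card C.carrier := by
      rw [Nat.card_coe_set_eq, ← Set.ncard_image_of_injective _ Subtype.val_injective, ← hC,
        ← Set.ncard_coe_finset, ← Set.ncard_image_of_injective _ Subtype.val_injective]
      congr 1
      ext x
      simp [and_comm]
    rw [this]
    exact (card_carrier_dvd C).trans H.card_subgroup_dvd_card

variable {k : Type v} [Field k]

variable (k c) in
/-- The sum of the `m`-th powers of all letters. -/
noncomputable def powerSum [Fintype c.carrier] (m : ℕ) : ComponentRing k c :=
  ∑ g : c.carrier, MonoidAlgebra.of k (ComponentMonoid c) (letter g ^ m)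

theorem powerSum_mem_grading [Fintype c.carrier] (m : ℕ) : powerSum c k m ∈ grading k c m :=
  Submodule.sum_mem _ fun g _ => Submodule.subset_span ⟨_, len_letter_pow g m, rfl⟩

theorem asAlgebraHom_powerSum [Fintype c.carrier] {M : Type w} [AddCommGroup M] [Module k M]
    (ρ : Representation k (ComponentMonoid c) M) (m : ℕ) (x : M) :
    ρ.asAlgebraHom (powerSum c k m) x = ∑ g : c.carrier, ρ (letter g ^ m) x := by
  rw [powerSum, map_sum, LinearMap.sum_apply]
  simp only [Representation.asAlgebraHom_of]

variable [Finite G] [Fintype c.carrier] {m n : ℕ}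

/-- Induction upwards on the support subgroup. With smaller supports already excluded, only `s`
itself contributes to the coefficient at `stabMap m s`, once for each letter in its support. -/
theorem NonSplitting.eq_zero_of_powerSum (hc : NonSplitting c) (hk : (Nat.card G : k) ≠ 0)
    (hm : ∀ g : c.carrier, (g : G) ^ m = 1) (hm0 : m ≠ 0) (hn : n ≠ 0)
    (hinj : Set.InjOn (stabMap m) {s : ComponentMonoid c | len s = n})
    {x : ComponentMonoid c →₀ k} (hx : ∀ t, x t ≠ 0 → len t = n)
    (h0 : (freeRep k _ k).asAlgebraHom (powerSum c k m) x = 0) : x = 0 := by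
  classical
  suffices ∀ (H : Subgroup G) s, supportSubgroup s = H → x s = 0 from
    Finsupp.ext fun s => this _ s rfl
  intro H
  induction H using WellFoundedLT.induction with
  | _ H ih =>
    rintro s rfl
    by_contra hs
    obtain ⟨a, ha⟩ := exists_mem_supportSubgroup (s := s) (by rw [hx s hs]; exact hn)
    have hsupp : supportSubgroup (stabMap m s) = supportSubgroup s := by
      rw [← hc.letter_pow_mul_eq_stabMap hm ha, supportSubgroup_mul,
        supportSubgroup_letter_pow a hm0]
      exact sup_eq_right.2 (Subgroup.zpowers_le.2 ha)
    have key (g : c.carrier) : freeRep k _ k (letter g ^ m) x (stabMap m s) =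
        if (g : G) ∈ supportSubgroup s then x s else 0 := by
      have h1 : freeRep k _ k (letter g ^ m) x (stabMap m s) =
          ∑ t ∈ x.support, if letter g ^ m * t = stabMap m s then x t else 0 := by
        conv_lhs => rw [← Finsupp.sum_single x]
        rw [Finsupp.sum, map_sum, Finsupp.finsetSum_apply]
        refine Finset.sum_congr rfl fun t _ => ?_
        rw [freeRep_single, Finsupp.single_apply]
      -- Such a `t` has support inside that of `s`, hence equal to it by induction; then its product
      -- is `stabMap m t`, and injectivity gives `t = s`.
      have h2 (t) (ht : t ∈ x.support) (he : letter g ^ m * t = stabMap m s) :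
          (g : G) ∈ supportSubgroup s ∧ t = s := by
        have hle : supportSubgroup (letter g ^ m * t) = supportSubgroup s := by rw [he, hsupp]
        rw [supportSubgroup_mul, supportSubgroup_letter_pow g hm0] at hle
        have hg : (g : G) ∈ supportSubgroup s := Subgroup.zpowers_le.1 (le_sup_left.trans hle.le)
        have hts : supportSubgroup t = supportSubgroup s := by
          refine (le_sup_right.trans hle.le).eq_of_not_lt fun hlt => ?_
          exact Finsupp.mem_support_iff.1 ht (ih _ hlt t rfl)
        rw [hc.letter_pow_mul_eq_stabMap hm (hts.symm ▸ hg)] at he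
        exact ⟨hg, hinj (hx t (Finsupp.mem_support_iff.1 ht)) (hx s hs) he⟩
      rw [h1]
      split_ifs with hg
      · rw [Finset.sum_eq_single s, if_pos (hc.letter_pow_mul_eq_stabMap hm hg)]
        · exact fun t ht hne => if_neg fun he => hne (h2 t ht he).2
        · exact fun h => absurd (Finsupp.mem_support_iff.2 hs) h
      · exact Finset.sum_eq_zero fun t ht => if_neg fun he => hg (h2 t ht he).1
    have hsum := DFunLike.congr_fun h0 (stabMap m s)
    rw [asAlgebraHom_powerSum, Finsupp.finsetSum_apply, Finset.sum_congr rfl fun g _ => key g,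
      ← Finset.sum_filter, Finset.sum_const, nsmul_eq_mul, Finsupp.zero_apply] at hsum
    have hcard := (mul_eq_zero.1 hsum).resolve_right hs
    obtain ⟨e, he⟩ := hc.card_filter_dvd ⟨a, ha⟩
    exact hk (by rw [he, Nat.cast_mul, hcard, zero_mul])

/-- Induction downwards on the support subgroup. Applied to a preimage `t` of `s` under `stabMap`,
the power sum gives an invertible multiple of `s` plus components of strictly larger support. -/
theorem NonSplitting.exists_powerSum_eq (hc : NonSplitting c) (hk : (Nat.card G : k) ≠ 0)
    (hm : ∀ g : c.carrier, (g : G) ^ m = 1) (hm0 : m ≠ 0) (hn : n ≠ 0)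
    (hsurj : ∀ s : ComponentMonoid c, len s = n + m → ∃ t, len t = n ∧ stabMap m t = s ∧
      supportSubgroup t = supportSubgroup s) {s : ComponentMonoid c} (hs : len s = n + m) :
    Finsupp.single s 1 ∈ (Finsupp.supported k k {t : ComponentMonoid c | len t = n}).map
      ((freeRep k _ k).asAlgebraHom (powerSum c k m)) := by
  classical
  suffices ∀ (H : Subgroup G) s, supportSubgroup s = H → len s = n + m →
      Finsupp.single s 1 ∈ (Finsupp.supported k k {t : ComponentMonoid c | len t = n}).map
        ((freeRep k _ k).asAlgebraHom (powerSum c k m)) from this _ s rfl hs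
  clear hs s
  intro H
  induction H using WellFoundedGT.induction with
  | _ H ih =>
    rintro s rfl hs
    obtain ⟨t, ht, hts, hsupp⟩ := hsurj s hs
    obtain ⟨a, ha⟩ := exists_mem_supportSubgroup (s := t) (by rw [ht]; exact hn)
    set P := (Finsupp.supported k k {t : ComponentMonoid c | len t = n}).map
      ((freeRep k _ k).asAlgebraHom (powerSum c k m)) with hP
    have hmem : (freeRep k _ k).asAlgebraHom (powerSum c k m) (Finsupp.single t 1) ∈ P :=
      Submodule.mem_map_of_mem (Finsupp.single_mem_supported k _ ht)
    rw [asAlgebraHom_powerSum,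
      ← Finset.sum_filter_add_sum_filter_not _ fun g : c.carrier => (g : G) ∈ supportSubgroup t]
      at hmem
    have h1 : ∑ g ∈ Finset.univ.filter fun g : c.carrier => (g : G) ∈ supportSubgroup t,
        freeRep k _ k (letter g ^ m) (Finsupp.single t 1) =
        ((Finset.univ.filter fun g : c.carrier => (g : G) ∈ supportSubgroup t).card : k) •
          Finsupp.single s 1 := by
      rw [Finset.sum_congr rfl (g := fun _ => Finsupp.single s 1), Finset.sum_const,
        Nat.cast_smul_eq_nsmul]
      intro g hg
      rw [freeRep_single, hc.letter_pow_mul_eq_stabMap hm (Finset.mem_filter.1 hg).2, hts]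
    have h2 : ∑ g ∈ Finset.univ.filter fun g : c.carrier => (g : G) ∉ supportSubgroup t,
        freeRep k _ k (letter g ^ m) (Finsupp.single t 1) ∈ P := by
      refine Submodule.sum_mem _ fun g hg => ?_
      rw [freeRep_single]
      refine ih _ ?_ _ rfl (by rw [len_mul, len_letter_pow, ht, add_comm])
      rw [supportSubgroup_mul, supportSubgroup_letter_pow g hm0, ← hsupp]
      exact right_lt_sup.2 fun h => (Finset.mem_filter.1 hg).2 (Subgroup.zpowers_le.1 h)
    rw [h1, Submodule.add_mem_iff_left _ h2] at hmem
    refine (Submodule.smul_mem_iff _ fun hcard => ?_).1 hmem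
    obtain ⟨e, he⟩ := hc.card_filter_dvd ⟨a, ha⟩
    exact hk (by rw [he, Nat.cast_mul, hcard, zero_mul])

/-- For a non-splitting pair, the sum of the `|G|`-th powers of all letters is stabilizing from
some grading on that does not depend on the field. -/
theorem NonSplitting.exists_isLeftStable (hc : NonSplitting c) :
    ∃ N₀, Nat.card G ≤ N₀ ∧ ∀ (k : Type v) [Field k], (Nat.card G : k) ≠ 0 →
      IsLeftStable len (Nat.card G) N₀ (powerSum c k (Nat.card G)) := by
  have hm (g : c.carrier) : (g : G) ^ Nat.card G = 1 := pow_card_eq_one'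
  have hm0 : Nat.card G ≠ 0 := Nat.card_pos.ne'
  obtain ⟨n₁, hn₁, h⟩ := hc.exists_bijective_stabMap hm
  -- The bound `n₁` concerns source gradings, whereas `N₀` bounds target gradings, hence the shift
  -- by |G|.
  refine ⟨n₁ + Nat.card G, by omega, fun k _ hk => ⟨mem_grading_iff.1 (powerSum_mem_grading _),
    fun n hn x hx h0 => ?_, fun n hn s hs => ?_⟩⟩
  · exact hc.eq_zero_of_powerSum hk hm hm0 (by omega : n - Nat.card G ≠ 0)
      (h _ (by omega)).1 hx h0
  · obtain ⟨x, hx, hxs⟩ := hc.exists_powerSum_eq hk hm hm0 (by omega : n - Nat.card G ≠ 0)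
      (h _ (by omega)).2 (s := s) (by omega)
    exact ⟨x, fun t ht => (Finsupp.mem_supported k x).1 hx (Finsupp.mem_support_iff.2 ht), hxs⟩

end StableElement

end Hurwitz

theorem mainTheorem8 {G : Type*} [Group G] [Finite G] (c : ConjClasses G)
    (hc : Hurwitz.NonSplitting c) :
    (∃ B₁ : ℕ, ∀ (k : Type*) [Field k], IsUnit (Nat.card G : k) →
      ∀ (M : Type*) [AddCommGroup M] [Module k M] [Module (Hurwitz.ComponentRing k c) M]
        [IsScalarTower k (Hurwitz.ComponentRing k c) M] (ℳ : ℕ → Submodule k M)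
        [DirectSum.Decomposition ℳ] [SetLike.GradedSMul (Hurwitz.grading k c) ℳ]
        (d : ℕ), 1 ≤ d →
        Hurwitz.hR k c ℳ d ≤
          max (Hurwitz.hR k c ℳ 0) (Hurwitz.hR k c ℳ 1) + ((B₁ * (d - 1) : ℕ) : ℕ∞)) ∧
    (∀ (k : Type*) [Field k], IsUnit (Nat.card G : k) →
      ∀ (N N₀ : ℕ) (U : Hurwitz.ComponentRing k c), 0 < N → N ≤ N₀ →
      Hurwitz.IsStabilizing k c N N₀ U →
      ∀ (M : Type*) [AddCommGroup M] [Module k M] [Module (Hurwitz.ComponentRing k c) M]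
        [IsScalarTower k (Hurwitz.ComponentRing k c) M] (ℳ : ℕ → Submodule k M)
        [DirectSum.Decomposition ℳ] [SetLike.GradedSMul (Hurwitz.grading k c) ℳ]
        (d : ℕ), 1 ≤ d →
        Hurwitz.hR k c ℳ d ≤
          max (Hurwitz.hR k c ℳ 0) (Hurwitz.hR k c ℳ 1) + (((N₀ - 1) * (d - 1) : ℕ) : ℕ∞)) := by
  refine ⟨?_, fun k _ _ N N₀ U hN0 hN hU M _ _ _ _ ℳ _ _ d hd => hU.isLeftStable.hR_le ℳ hN0 hN hd⟩
  have := Fintype.ofFinite c.carrier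
  obtain ⟨N₀, hN₀, h⟩ := hc.exists_isLeftStable
  exact ⟨N₀ - 1, fun k _ hk M _ _ _ _ ℳ _ _ d hd =>
    (h k hk.ne_zero).hR_le ℳ Nat.card_pos hN₀ hd⟩
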